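/- Let $N\ge 1$, $\lambda>0$, $\sigma\in(0,2)$, let $\mathcal A$ be a separable metric space, and for $\alpha\in\mathcal A$ let $f^\alpha:\mathbb R^N\to\mathbb R$, $\eta^\alpha:\mathbb R^N\to\mathbb R^N$, and let $\nu_\alpha$ be a nonnegative Borel measure on $\mathbb R^N$. Consider $$\lambda u(x)+\sup_{\alpha\in\mathcal A}\{f^\alpha(x)-\mathcal I^\alpha[u](x)\}=0\quad\text{in }\mathbb R^N,\qquad(\ast)$$ $$\mathcal I^\alpha[\phi](x)=\int_{\mathbb R^N\setminus\{0\}}\big(\phi(x+\eta^\alpha(z))-\phi(x)-\eta^\alpha(z)\cdot\nabla\phi(x)1_{|z|<1}\big)\,\nu_\alpha(dz).$$ Assume that there are constants $K,C>0$ such that for all $\alpha\in\mathcal A$: * (A1) $f^\alpha(x)$ and $\eta^\alpha(z)$ are continuous in $\alpha$, in $x$ and in $z$; * (A2) $|f^\alpha(x)|\le K$, $|f^\alpha(x)-f^\alpha(y)|\le K|x-y|$ and $|\eta^\alpha(z)|\le K$ for all $x,y,z\in\mathbb R^N$; * (A3) $|\eta^\alpha(z)|\le K|z|$ for $|z|<1$;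 * (A4) $\int_{|z|\le1}|z|^2\,\nu_\alpha(dz)+\int_{|z|>1}\nu_\alpha(dz)\le K$; * (A5) $1_{|z|<1}\,\nu_\alpha(dz)$ is symmetric under $z\mapsto-z$; * (A6) $\nu_\alpha$ is absolutely continuous on $\{|z|<1\}$, with $0\le\frac{d\nu_\alpha}{dz}\le\frac{C}{|z|^{N+\sigma}}$ for a.e. $|z|<1$; * (A7) $\eta^\alpha(-z)=-\eta^\alpha(z)$ for $|z|<1$. Assume moreover: * (C1) there are $\alpha_0\in\mathcal A$, $c_{\alpha_0}>0$ and $K_0\ge0$ such that $\frac{d\nu_{\alpha_0}}{dz}\ge\frac{c_{\alpha_0}}{|z|^{N+\sigma}}$ for a.e. $|z|<1$, and $|\eta^{\alpha_0}(z)-\eta^{\alpha_0}(0)-z|\le K_0|z|^2$ for $|z|<1$; * (C3) there are $\beta\in(0,1]$ with $\beta>(\sigma-1)^+$ and $K_1>0$ such that every $f^\alpha$ is differentiable and $|f^\alpha(x)|\le K_1$, $|Df^\alpha(x)|\le K_1$, $|Df^\alpha(x)-Df^\alpha(y)|\le K_1|x-y|^\beta$ for all $x,y$ and $\alpha$. Let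 $u$ be a bounded continuous viscosity solution of $(\ast)$; that is, whenever $\phi\in C^2(\mathbb R^N)$, $\delta>0$ and $u-\phi$ has a global maximum (respectively minimum) at $x$, one has $\lambda u(x)+\sup_\alpha\{f^\alpha(x)-I^{\alpha}_\delta[\phi,u](x)\}\le0$ (respectively $\ge0$), where $I^\alpha_\delta[\phi,u](x)$ is the integral defining $\mathcal I^\alpha$ with increments $\phi(x+\eta^\alpha(z))-\phi(x)$ for $|z|<\delta$, increments $u(x+\eta^\alpha(z))-u(x)$ for $|z|\ge\delta$, and compensator $\eta^\alpha(z)\cdot\nabla\phi(x)1_{|z|<1}$. Then the distribution $(-\Delta)^{\sigma/2}u$ is represented by a function in $L^\infty(\mathbb R^N)$: there is $g\in L^\infty(\mathbb R^N)$ such that for every $\phi\in C_c^\infty(\mathbb R^N)$ the function $u\,(-\Delta)^{\sigma/2}\phi$ is integrable and $$\int_{\mathbb R^N}u(x)\,(-\Delta)^{\sigma/2}\phi(x)\,dx=\int_{\mathbb R^N}g(x)\,\phi(x)\,dx .$$ Here, with $c_{N,\sigma}=\frac{2^{\sigma}\,\Gamma((N+\sigma)/2)}{\pi^{N/2}\,|\Gamma(-\sigma/2)|}$,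 $$(-\Delta)^{\sigma/2}\phi(x)=-\int_{\mathbb R^N}\big(\phi(x+z)-\phi(x)-z\cdot\nabla\phi(x)1_{|z|<1}\big)\frac{c_{N,\sigma}}{|z|^{N+\sigma}}\,dz .$$ -/

import Mathlib

open MeasureTheory Metric
open scoped ContDiff ENNReal

namespace NonlocalHJB

noncomputable section

/-- `ℝ^N` with the Euclidean norm. -/
abbrev Space (N : ℕ) : Type := EuclideanSpace ℝ (Fin N)

/-- The Lévy operator with jump function `η` and Lévy measure `ν`,
`I[φ](x) = ∫_{ℝ^N ∖ {0}} (φ(x + η(z)) - φ(x) - η(z) · ∇φ(x) 1_{|z| < 1}) ν(dz)`. -/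
def levyOp {N : ℕ} (η : Space N → Space N) (ν : Measure (Space N))
    (φ : Space N → ℝ) (x : Space N) : ℝ :=
  ∫ z in ({0}ᶜ : Set (Space N)),
    (φ (x + η z) - φ x - (if ‖z‖ < 1 then fderiv ℝ φ x (η z) else 0)) ∂ν

/-- The Lévy operator evaluated on a test function `φ` for the jumps `|z| < δ` and on the
(possibly nonsmooth) function `u` for the jumps `|z| ≥ δ`, with the gradient of `φ` in the
compensator:
`∫_{0 < |z| < δ} (φ(x + η(z)) - φ(x) - η(z) · ∇φ(x) 1_{|z| < 1}) ν(dz)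
  + ∫_{|z| ≥ δ} (u(x + η(z)) - u(x) - η(z) · ∇φ(x) 1_{|z| < 1}) ν(dz)`.
For `u = φ` it is `levyOp η ν φ x`. -/
def levyOpSplit {N : ℕ} (η : Space N → Space N) (ν : Measure (Space N)) (δ : ℝ)
    (φ u : Space N → ℝ) (x : Space N) : ℝ :=
  ∫ z in ({0}ᶜ : Set (Space N)),
    ((if ‖z‖ < δ then φ (x + η z) - φ x else u (x + η z) - u x)
      - (if ‖z‖ < 1 then fderiv ℝ φ x (η z) else 0)) ∂ν

/-- `u` is a viscosity subsolution of `l u + sup_α {f^α - I^α[u]} = 0` in `ℝ^N`. -/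
def IsViscositySubsolution {N : ℕ} {A : Type*} (l : ℝ) (f : A → Space N → ℝ)
    (η : A → Space N → Space N) (ν : A → Measure (Space N)) (u : Space N → ℝ) : Prop :=
  ∀ (φ : Space N → ℝ) (x : Space N) (δ : ℝ), ContDiff ℝ 2 φ → 0 < δ →
    (∀ y, u y - φ y ≤ u x - φ x) →
    l * u x + ⨆ α, (f α x - levyOpSplit (η α) (ν α) δ φ u x) ≤ 0

/-- `u` is a viscosity supersolution of `l u + sup_α {f^α - I^α[u]} = 0` in `ℝ^N`. -/
def IsViscositySupersolution {N : ℕ} {A : Type*} (l : ℝ) (f : A → Space N → ℝ)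
    (η : A → Space N → Space N) (ν : A → Measure (Space N)) (u : Space N → ℝ) : Prop :=
  ∀ (φ : Space N → ℝ) (x : Space N) (δ : ℝ), ContDiff ℝ 2 φ → 0 < δ →
    (∀ y, u x - φ x ≤ u y - φ y) →
    0 ≤ l * u x + ⨆ α, (f α x - levyOpSplit (η α) (ν α) δ φ u x)

/-- `u` is a bounded continuous viscosity solution of `l u + sup_α {f^α - I^α[u]} = 0`. -/
structure IsViscositySolution {N : ℕ} {A : Type*} (l : ℝ) (f : A → Space N → ℝ)
    (η : A → Space N → Space N) (ν : A → Measure (Space N)) (u : Space N → ℝ) : Prop where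
  continuous : Continuous u
  bounded : ∃ B : ℝ, ∀ x, |u x| ≤ B
  subsolution : IsViscositySubsolution l f η ν u
  supersolution : IsViscositySupersolution l f η ν u

/-- The normalizing constant `2^σ Γ((N + σ)/2) / (π^{N/2} |Γ(-σ/2)|)` of `(-Δ)^{σ/2}`. -/
def fracLaplacianConst (N : ℕ) (σ : ℝ) : ℝ :=
  (2 : ℝ) ^ σ * Real.Gamma (((N : ℝ) + σ) / 2) /
    (Real.pi ^ ((N : ℝ) / 2) * |Real.Gamma (-(σ / 2))|)

/-- The fractional Laplacian `(-Δ)^{σ/2}` on smooth functions, as a singular integral: `-(-Δ)^{σ/2}`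
is the Lévy operator with `η(z) = z` and `ν(dz) = c_{N,σ} |z|^{-N-σ} dz`. -/
def fracLaplacian {N : ℕ} (σ : ℝ) (φ : Space N → ℝ) (x : Space N) : ℝ :=
  -∫ z : Space N, (φ (x + z) - φ x - (if ‖z‖ < 1 then fderiv ℝ φ x z else 0)) *
    (fracLaplacianConst N σ / ‖z‖ ^ ((N : ℝ) + σ))

/-- The distribution `(-Δ)^{σ/2} u`, that is `φ ↦ ∫ u (-Δ)^{σ/2} φ dx` on `C_c^∞(ℝ^N)`, is
well defined and represented by the function `g`. -/
def FracLaplacianRepresentedBy {N : ℕ} (σ : ℝ) (u g : Space N → ℝ) : Prop :=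
  ∀ φ : Space N → ℝ, ContDiff ℝ ∞ φ → HasCompactSupport φ →
    Integrable (fun x => u x * fracLaplacian σ φ x) volume ∧
    ∫ x, u x * fracLaplacian σ φ x = ∫ x, g x * φ x

/-- The density `dν/dz` of `ν` with respect to Lebesgue measure on the unit ball. -/
def ballDensity {N : ℕ} (ν : Measure (Space N)) : Space N → ℝ≥0∞ :=
  (ν.restrict (ball 0 1)).rnDeriv volume

end

end NonlocalHJB

namespace NonlocalHJB

/-! ### Kernels and Lévy measures -/

/-! The equation is translation invariant apart from `f`, and this gives one-sided regularity of
`u`. Comparing `u` at the three points `w + h₁`, `w + h₂`, `w` yields `l (u(w + h₁) + u(w + h₂) - 2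
u(w)) ≤ sup (2 f(w) - f(w + h₁) - f(w + h₂))`, the supremum being over controls and points
(`second_difference_le`). The argument is the usual comparison proof: a control almost optimal for
the supersolution property at `w` is admissible in the subsolution property at the other two points.
The choice `h₂ = 0` gives a Lipschitz bound, and `h₂ = -h₁` gives semiconcavity of order `1 + β`,
which exceeds `σ`.

The opposite bound is needed only in integrated form, and one nondegenerate control `α₀` provides
it. The subsolution property says `I^{α₀}[u] ≥ l u + f^{α₀}`, which is bounded below. By symmetry of
the measure and oddness of the jumps, the part over the unit ball is half the integral of second
differences of `u`. Their positive parts are integrable uniformly in the point because `1 + β > σ`,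
so the negative parts are as well, first at points touched from above by a paraboloid and then
everywhere by density and Fatou (`lintegral_stableBall_le`). The lower density bound and the
closeness of `η^{α₀}(z)` to `z` turn this into a uniform bound on `∫ |u(x + z) + u(x - z) - 2 u(x)|
|z|^{-N-σ} dz`.

The fractional Laplacian of `u` is then an absolutely convergent bounded integral, and Fubini moves
the second difference from the test function to `u` (`exists_fracLaplacian_representation`). -/

theorem integrable_min_rpow_div {N : ℕ} (hN : 1 ≤ N) {σ s : ℝ} (hσ : 0 < σ) (hs : σ < s) :
    Integrable (fun z : Space N => min 1 (‖z‖ ^ s) / ‖z‖ ^ ((N : ℝ) + σ)) volume := by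
  have : Nonempty (Fin N) := ⟨⟨0, hN⟩⟩
  rw [integrable_fun_norm_addHaar (E := Space N) (F := ℝ) volume
    (f := fun r => min 1 (r ^ s) / r ^ ((N : ℝ) + σ)), finrank_euclideanSpace_fin]
  have hN' : ((N - 1 : ℕ) : ℝ) = N - 1 := by rw [Nat.cast_sub hN]; simp
  rw [← Set.Ioc_union_Ioi_eq_Ioi zero_le_one]
  refine IntegrableOn.union ?_ ?_
  · have h : IntegrableOn (fun y : ℝ => y ^ (s - 1 - σ)) (Set.Ioc 0 1) := by
      rw [integrableOn_Ioc_iff_integrableOn_Ioo, intervalIntegral.integrableOn_Ioo_rpow_iff one_pos]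
      linarith
    refine h.congr_fun (fun y hy => ?_) measurableSet_Ioc
    have hy0 : 0 < y := hy.1
    have : y ^ s ≤ 1 := Real.rpow_le_one hy0.le hy.2 (by linarith)
    simp only [smul_eq_mul]
    rw [min_eq_right this, ← Real.rpow_natCast, hN', ← Real.rpow_sub hy0, ← Real.rpow_add hy0]
    congr 1; ring
  · have h : IntegrableOn (fun y : ℝ => y ^ (- 1 - σ)) (Set.Ioi 1) :=
      integrableOn_Ioi_rpow_of_lt (by linarith) one_pos
    refine h.congr_fun (fun y hy => ?_) measurableSet_Ioi
    have hy1 : 1 < y := hy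
    have hy0 : 0 < y := by linarith
    have : 1 ≤ y ^ s := Real.one_le_rpow hy1.le (by linarith)
    simp only [smul_eq_mul]
    rw [min_eq_left this, ← Real.rpow_natCast, hN', one_div, ← Real.rpow_neg hy0.le,
      ← Real.rpow_add hy0]
    congr 1; ring

theorem integrable_min_sq_div {N : ℕ} (hN : 1 ≤ N) {σ : ℝ} (hσ : 0 < σ ∧ σ < 2) :
    Integrable (fun z : Space N => min 1 (‖z‖ ^ 2) / ‖z‖ ^ ((N : ℝ) + σ)) volume := by
  simpa using integrable_min_rpow_div hN hσ.1 hσ.2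

theorem lintegral_min_sq_le {N : ℕ} {ν : Measure (Space N)} {K : ℝ}
    (h : (∫⁻ z in closedBall 0 1, ENNReal.ofReal (‖z‖ ^ 2) ∂ν) + ν (closedBall 0 1)ᶜ
      ≤ ENNReal.ofReal K) :
    ∫⁻ z, ENNReal.ofReal (min 1 (‖z‖ ^ 2)) ∂ν ≤ ENNReal.ofReal K := by
  rw [← lintegral_add_compl _ (measurableSet_closedBall (x := (0 : Space N)) (ε := 1))]
  refine le_trans (add_le_add ?_ ?_) h
  · exact lintegral_mono fun z => ENNReal.ofReal_le_ofReal (min_le_right _ _)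
  · refine (lintegral_mono (g := fun _ => 1) fun z => ?_).trans (by simp)
    simp

/-- By Chebyshev, the Lévy bound makes the mass finite away from the origin. This is what allows the
Radon–Nikodym density to recover the measure. -/
theorem sigmaFinite_restrict_ball {N : ℕ} (hN : 1 ≤ N) {ν : Measure (Space N)} {K : ℝ}
    (h : ∫⁻ z, ENNReal.ofReal (min 1 (‖z‖ ^ 2)) ∂ν ≤ ENNReal.ofReal K)
    (hac : ν.restrict (ball 0 1) ≪ volume) : SigmaFinite (ν.restrict (ball 0 1)) := by
  have : Nonempty (Fin N) := ⟨⟨0, hN⟩⟩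
  let S : ℕ → Set (Space N) := fun n => {z | ENNReal.ofReal (1 / (n + 1)) ≤
    ENNReal.ofReal (min 1 (‖z‖ ^ 2))}
  refine Measure.sigmaFinite_of_countable (S := insert {0} (Set.range S))
    ((Set.countable_range S).insert _) ?_ ?_
  · rintro s (rfl | ⟨n, rfl⟩)
    -- The weight `min 1 |z|²` vanishes at the origin, so the Lévy bound does not exclude an atom
    -- there; absolute continuity does.
    · rw [hac (measure_singleton 0)]; exact ENNReal.zero_lt_top
    · refine (Measure.restrict_apply_le _ _).trans_lt ?_
      refine (meas_ge_le_lintegral_div (by fun_prop) ?_ ENNReal.ofReal_ne_top).trans_lt ?_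
      · have : (0 : ℝ) < 1 / (n + 1) := by positivity
        simpa using this
      · refine ENNReal.div_lt_top (h.trans_lt ENNReal.ofReal_lt_top).ne ?_
        have : (0 : ℝ) < 1 / (n + 1) := by positivity
        simpa using this
  · refine Set.eq_univ_of_forall fun z => ?_
    by_cases hz : z = 0
    · exact ⟨{0}, Set.mem_insert _ _, hz⟩
    · have : 0 < min 1 (‖z‖ ^ 2) := lt_min one_pos (by positivity)
      obtain ⟨n, hn⟩ := exists_nat_one_div_lt this
      exact ⟨S n, Set.mem_insert_of_mem _ ⟨n, rfl⟩, ENNReal.ofReal_le_ofReal hn.le⟩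

theorem restrict_ball_eq_withDensity {N : ℕ} (hN : 1 ≤ N) {ν : Measure (Space N)} {K : ℝ}
    (h : ∫⁻ z, ENNReal.ofReal (min 1 (‖z‖ ^ 2)) ∂ν ≤ ENNReal.ofReal K)
    (hac : ν.restrict (ball 0 1) ≪ volume) :
    ν.restrict (ball 0 1) = (volume.restrict (ball 0 1)).withDensity (ballDensity ν) := by
  have := sigmaFinite_restrict_ball hN h hac
  rw [← restrict_withDensity measurableSet_ball, ballDensity,
    Measure.withDensity_rnDeriv_eq _ _ hac, Measure.restrict_restrict measurableSet_ball,
    Set.inter_self]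

/-- The measure `C |z|^{-N-σ} dz` on the unit ball. -/
noncomputable def stableBall (N : ℕ) (σ C : ℝ) : Measure (Space N) :=
  (volume.restrict (ball 0 1)).withDensity fun z => ENNReal.ofReal (C / ‖z‖ ^ ((N : ℝ) + σ))

theorem restrict_ball_le_stableBall {N : ℕ} (hN : 1 ≤ N) {ν : Measure (Space N)} {K σ C : ℝ}
    (h : ∫⁻ z, ENNReal.ofReal (min 1 (‖z‖ ^ 2)) ∂ν ≤ ENNReal.ofReal K)
    (hac : ν.restrict (ball 0 1) ≪ volume)
    (hC : ∀ᵐ z ∂(volume : Measure (Space N)), ‖z‖ < 1 →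
      ballDensity ν z ≤ ENNReal.ofReal (C / ‖z‖ ^ ((N : ℝ) + σ))) :
    ν.restrict (ball 0 1) ≤ stableBall N σ C := by
  rw [restrict_ball_eq_withDensity hN h hac]
  refine withDensity_mono ((ae_restrict_iff' measurableSet_ball).2 ?_)
  simpa [mem_ball_zero_iff] using hC

theorem stableBall_le_restrict_ball {N : ℕ} (hN : 1 ≤ N) {ν : Measure (Space N)} {K σ c : ℝ}
    (h : ∫⁻ z, ENNReal.ofReal (min 1 (‖z‖ ^ 2)) ∂ν ≤ ENNReal.ofReal K)
    (hac : ν.restrict (ball 0 1) ≪ volume)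
    (hc : ∀ᵐ z ∂(volume : Measure (Space N)), ‖z‖ < 1 →
      ENNReal.ofReal (c / ‖z‖ ^ ((N : ℝ) + σ)) ≤ ballDensity ν z) :
    stableBall N σ c ≤ ν.restrict (ball 0 1) := by
  rw [restrict_ball_eq_withDensity hN h hac]
  refine withDensity_mono ((ae_restrict_iff' measurableSet_ball).2 ?_)
  simpa [mem_ball_zero_iff] using hc

theorem integrable_stableBall {N : ℕ} {σ C : ℝ} {F : Space N → ℝ}
    (hC : 0 ≤ C)
    (hF : IntegrableOn (fun z => F z / ‖z‖ ^ ((N : ℝ) + σ)) (ball 0 1) volume) :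
    Integrable F (stableBall N σ C) := by
  rw [stableBall, integrable_withDensity_iff_integrable_smul' (by fun_prop)
    (Filter.Eventually.of_forall fun _ => ENNReal.ofReal_lt_top)]
  refine (Integrable.const_mul hF C).congr (Filter.Eventually.of_forall fun z => ?_)
  simp only [smul_eq_mul]
  rw [ENNReal.toReal_ofReal (by positivity)]
  ring

/-- Uniform bounds on a family of jump functions and Lévy measures. -/
structure IsUniformLevyFamily {N : ℕ} {A : Type*} (σ K C : ℝ) (η : A → Space N → Space N)
    (ν : A → Measure (Space N)) : Prop where
  pos : 0 < K
  const_nonneg : 0 ≤ C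
  continuous : ∀ α, Continuous (η α)
  bound : ∀ α z, ‖η α z‖ ≤ K
  lin : ∀ α z, ‖z‖ < 1 → ‖η α z‖ ≤ K * ‖z‖
  levy : ∀ α, ∫⁻ z, ENNReal.ofReal (min 1 (‖z‖ ^ 2)) ∂(ν α) ≤ ENNReal.ofReal K
  upper : ∀ α, (ν α).restrict (ball 0 1) ≤ stableBall N σ C

theorem integrable_min_sq {N : ℕ} {ν : Measure (Space N)} {K : ℝ}
    (h : ∫⁻ z, ENNReal.ofReal (min 1 (‖z‖ ^ 2)) ∂ν ≤ ENNReal.ofReal K) :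
    Integrable (fun z => min 1 (‖z‖ ^ 2)) ν := by
  refine ⟨(by fun_prop : Measurable _).aestronglyMeasurable, ?_⟩
  rw [hasFiniteIntegral_iff_ofReal (Filter.Eventually.of_forall fun z => by positivity)]
  exact h.trans_lt ENNReal.ofReal_lt_top

theorem integral_min_sq_le {N : ℕ} {ν : Measure (Space N)} {K : ℝ} (hK : 0 ≤ K)
    (h : ∫⁻ z, ENNReal.ofReal (min 1 (‖z‖ ^ 2)) ∂ν ≤ ENNReal.ofReal K) :
    ∫ z, min 1 (‖z‖ ^ 2) ∂ν ≤ K := by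
  rw [integral_eq_lintegral_of_nonneg_ae (Filter.Eventually.of_forall fun z => by positivity)
    (by fun_prop : Measurable _).aestronglyMeasurable]
  exact ENNReal.toReal_le_of_le_ofReal hK h

theorem integrable_indicator_ball_sq {N : ℕ} {μ : Measure (Space N)}
    (h : Integrable (fun z => min 1 (‖z‖ ^ 2)) μ) {δ : ℝ} (hδ1 : δ ≤ 1) :
    Integrable (fun z => (ball (0 : Space N) δ).indicator (fun z => ‖z‖ ^ 2) z) μ := by
  refine h.mono' ((by fun_prop : Measurable fun z : Space N => ‖z‖ ^ 2).indicator
    measurableSet_ball).aestronglyMeasurable (Filter.Eventually.of_forall fun z => ?_)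
  by_cases hz : z ∈ ball (0 : Space N) δ
  · rw [Set.indicator_of_mem hz, Real.norm_of_nonneg (by positivity)]
    refine le_min (pow_le_one₀ (norm_nonneg z) ?_) le_rfl
    rw [mem_ball_zero_iff] at hz
    exact hz.le.trans hδ1
  · rw [Set.indicator_of_notMem hz, norm_zero]; positivity

/-- Domination by the single measure `stableBall N σ C` makes the radius uniform in the control.
Uniformity is essential: in the comparison argument `δ` must be fixed before the supersolution
property selects a control. -/
theorem IsUniformLevyFamily.exists_small_ball {N : ℕ} (hN : 1 ≤ N) {A : Type*} {σ K C : ℝ}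
    (hσ : 0 < σ ∧ σ < 2)
    {η : A → Space N → Space N} {ν : A → Measure (Space N)}
    (H : IsUniformLevyFamily σ K C η ν) {r : ℝ} (hr : 0 < r) (tol : ℝ) (htol : 0 < tol) :
    ∃ δ > 0, δ ≤ 1 ∧ δ ≤ r ∧
      ∀ α, ∫ z, (ball 0 δ).indicator (fun z => ‖z‖ ^ 2) z ∂(ν α) ≤ tol := by
  have hint : Integrable (fun z : Space N => min 1 (‖z‖ ^ 2)) (stableBall N σ C) :=
    integrable_stableBall H.const_nonneg (integrable_min_sq_div hN hσ).integrableOn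
  have hlim : Filter.Tendsto (fun n : ℕ => ∫ z, (ball 0 (1 / ((n : ℝ) + 1))).indicator
      (fun z : Space N => ‖z‖ ^ 2) z ∂(stableBall N σ C)) Filter.atTop (nhds 0) := by
    rw [← integral_zero (Space N) ℝ (μ := stableBall N σ C)]
    refine tendsto_integral_of_dominated_convergence _
      (fun n => ((by fun_prop : Measurable fun z : Space N => ‖z‖ ^ 2).indicator
        measurableSet_ball).aestronglyMeasurable) hint (fun n => ?_) ?_
    · refine Filter.Eventually.of_forall fun z => ?_
      by_cases hz : z ∈ ball (0 : Space N) (1 / ((n : ℝ) + 1))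
      · rw [Set.indicator_of_mem hz, Real.norm_of_nonneg (by positivity)]
        refine le_min (pow_le_one₀ (norm_nonneg z) ?_) le_rfl
        rw [mem_ball_zero_iff] at hz
        refine hz.le.trans ?_
        rw [div_le_one (by positivity)]
        linarith [(Nat.cast_nonneg n : (0 : ℝ) ≤ n)]
      · rw [Set.indicator_of_notMem hz, norm_zero]; positivity
    · refine Filter.Eventually.of_forall fun z => ?_
      by_cases hz : z = 0
      · refine tendsto_const_nhds.congr fun n => ?_
        subst hz
        by_cases h0 : (0 : Space N) ∈ ball (0 : Space N) (1 / ((n : ℝ) + 1)) <;> simp [Set.indicator]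
      · obtain ⟨n, hn⟩ := exists_nat_one_div_lt (norm_pos_iff.2 hz)
        refine tendsto_const_nhds.congr' ?_
        filter_upwards [Filter.eventually_ge_atTop n] with m hm
        rw [Set.indicator_of_notMem]
        rw [mem_ball_zero_iff, not_lt]
        refine le_trans ?_ hn.le
        exact Nat.one_div_le_one_div hm
  obtain ⟨n₀, hn₀⟩ := exists_nat_one_div_lt hr
  obtain ⟨n, hn, hnn⟩ := ((hlim.eventually_lt_const htol).and
    (Filter.eventually_ge_atTop n₀)).exists
  have hδ1 : 1 / ((n : ℝ) + 1) ≤ 1 := by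
    rw [div_le_one (by positivity)]
    linarith [(Nat.cast_nonneg n : (0 : ℝ) ≤ n)]
  refine ⟨1 / ((n : ℝ) + 1), by positivity, hδ1,
    (Nat.one_div_le_one_div hnn).trans hn₀.le, fun α => ?_⟩
  refine le_trans ?_ hn.le
  have hsub : ∀ μ : Measure (Space N), ∫ z, (ball 0 (1 / ((n : ℝ) + 1))).indicator
      (fun z : Space N => ‖z‖ ^ 2) z ∂μ = ∫ z, (ball 0 (1 / ((n : ℝ) + 1))).indicator
      (fun z : Space N => ‖z‖ ^ 2) z ∂(μ.restrict (ball 0 1)) := fun μ => by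
    rw [integral_indicator measurableSet_ball, integral_indicator measurableSet_ball,
      Measure.restrict_restrict measurableSet_ball,
      Set.inter_eq_self_of_subset_left (ball_subset_ball hδ1)]
  rw [hsub (ν α)]
  refine integral_mono_measure (H.upper α) (Filter.Eventually.of_forall fun z =>
    Set.indicator_nonneg (fun _ _ => by positivity) z)
    (integrable_indicator_ball_sq hint hδ1)

/-! ### Second order jets of viscosity solutions -/

/-- The integrand of `levyOpSplit` for the test function `y ↦ ⟪p, y - x⟫ + a ‖y - x‖²`. -/
noncomputable def jetIntegrand {N : ℕ} (η : Space N → Space N) (δ a : ℝ) (p : Space N)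
    (u : Space N → ℝ) (x z : Space N) : ℝ :=
  if ‖z‖ < δ then a * ‖η z‖ ^ 2
  else u (x + η z) - u x - (if ‖z‖ < 1 then inner ℝ p (η z) else 0)

theorem measurable_jetIntegrand {N : ℕ} {η : Space N → Space N} (hη : Continuous η) (δ a : ℝ)
    (p : Space N) {u : Space N → ℝ} (hu : Continuous u) (x : Space N) :
    Measurable (jetIntegrand η δ a p u x) := by
  unfold jetIntegrand
  refine Measurable.ite (measurableSet_lt (by fun_prop) (by fun_prop))
    (by fun_prop : Continuous _).measurable (Measurable.sub
      (by fun_prop : Continuous _).measurable ?_)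
  exact Measurable.ite (measurableSet_lt (by fun_prop) (by fun_prop))
    (by fun_prop : Continuous _).measurable measurable_const

theorem IsUniformLevyFamily.abs_jetIntegrand_le {N : ℕ} {A : Type*} {σ K C : ℝ}
    {η : A → Space N → Space N} {ν : A → Measure (Space N)}
    (H : IsUniformLevyFamily σ K C η ν) {u : Space N → ℝ} {B : ℝ} (hB : ∀ x, |u x| ≤ B)
    {δ : ℝ} (hδ : 0 < δ) (hδ1 : δ ≤ 1) (a : ℝ) (p x z : Space N) (α : A) :
    |jetIntegrand (η α) δ a p u x z| ≤
      (|a| * K ^ 2 + (2 * B + ‖p‖ * K) / δ ^ 2) * min 1 (‖z‖ ^ 2) := by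
  have hK := H.pos
  have hB0 : 0 ≤ B := (abs_nonneg _).trans (hB 0)
  have h1 : 0 ≤ |a| * K ^ 2 := by positivity
  have h2 : 0 ≤ (2 * B + ‖p‖ * K) / δ ^ 2 := by positivity
  unfold jetIntegrand
  split_ifs with hz hz1
  · have hz1 : ‖z‖ ^ 2 ≤ 1 := pow_le_one₀ (norm_nonneg z) (hz.le.trans hδ1)
    rw [min_eq_right hz1, abs_mul, abs_of_nonneg (by positivity : 0 ≤ ‖η α z‖ ^ 2), add_mul]
    have : ‖η α z‖ ^ 2 ≤ (K * ‖z‖) ^ 2 :=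
      pow_le_pow_left₀ (norm_nonneg _) (H.lin α z (hz.trans_le hδ1)) 2
    calc |a| * ‖η α z‖ ^ 2 ≤ |a| * (K * ‖z‖) ^ 2 := by gcongr
      _ = |a| * K ^ 2 * ‖z‖ ^ 2 + 0 := by ring
      _ ≤ _ := by gcongr; positivity
  all_goals
    -- Away from the `δ`-ball a constant is at most `δ⁻²` times the Lévy weight.
    have hm : δ ^ 2 ≤ min 1 (‖z‖ ^ 2) := by
      rw [not_lt] at hz
      exact le_min (pow_le_one₀ hδ.le hδ1) (pow_le_pow_left₀ hδ.le hz 2)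
    have hin : |inner ℝ p (η α z)| ≤ ‖p‖ * K :=
      (abs_real_inner_le_norm _ _).trans (by gcongr; exact H.bound α z)
    have hpK : 0 ≤ ‖p‖ * K := by positivity
    have hmain : 2 * B + ‖p‖ * K ≤
        (|a| * K ^ 2 + (2 * B + ‖p‖ * K) / δ ^ 2) * min 1 (‖z‖ ^ 2) := by
      calc 2 * B + ‖p‖ * K = (2 * B + ‖p‖ * K) / δ ^ 2 * δ ^ 2 := by field_simp
        _ ≤ (|a| * K ^ 2 + (2 * B + ‖p‖ * K) / δ ^ 2) * min 1 (‖z‖ ^ 2) := by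
          gcongr; linarith
    refine le_trans ?_ hmain
    have b1 := abs_le.1 (hB (x + η α z))
    have b2 := abs_le.1 (hB x)
    have b3 := abs_le.1 hin
    rw [abs_le]; constructor <;> linarith [b1.1, b1.2, b2.1, b2.2, b3.1, b3.2]

theorem IsUniformLevyFamily.integrable_jetIntegrand {N : ℕ} {A : Type*} {σ K C : ℝ}
    {η : A → Space N → Space N} {ν : A → Measure (Space N)}
    (H : IsUniformLevyFamily σ K C η ν) {u : Space N → ℝ} (hu : Continuous u) {B : ℝ}
    (hB : ∀ x, |u x| ≤ B)
    {δ : ℝ} (hδ : 0 < δ) (hδ1 : δ ≤ 1) (a : ℝ) (p x : Space N) (α : A) :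
    Integrable (jetIntegrand (η α) δ a p u x) (ν α) :=
  ((integrable_min_sq (H.levy α)).const_mul _).mono'
    (measurable_jetIntegrand (H.continuous α) δ a p hu x).aestronglyMeasurable
    (Filter.Eventually.of_forall fun z => H.abs_jetIntegrand_le hB hδ hδ1 a p x z α)

/-- The quadratic test function at `x` with gradient `p` and second derivative `2 a`. -/
noncomputable def quadTest {N : ℕ} (a : ℝ) (p x y : Space N) : ℝ :=
  inner ℝ p (y - x) + a * ‖y - x‖ ^ 2

theorem contDiff_quadTest {N : ℕ} (a : ℝ) (p x : Space N) : ContDiff ℝ 2 (quadTest a p x) := by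
  unfold quadTest
  have h : ContDiff ℝ 2 fun y : Space N => y - x := by fun_prop
  exact (contDiff_const.inner ℝ h).add (contDiff_const.mul (h.norm_sq ℝ))

theorem fderiv_quadTest {N : ℕ} (a : ℝ) (p x h : Space N) :
    fderiv ℝ (quadTest a p x) x h = inner ℝ p h := by
  have h1 : HasFDerivAt (fun y : Space N => y - x) (ContinuousLinearMap.id ℝ (Space N)) x :=
    (hasFDerivAt_id x).sub_const x
  have h2 : HasFDerivAt (fun y : Space N => inner ℝ p (y - x)) (innerSL ℝ p) x := by
    simpa [inner_sub_right] using ((innerSL ℝ p).hasFDerivAt (x := x)).sub_const (inner ℝ p x)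
  have h3 : HasFDerivAt (quadTest a p x) _ x := h2.add (h1.norm_sq.const_mul a)
  rw [h3.fderiv]
  simp

/-- Since `δ ≤ 1`, the compensator is active for all jumps given to the test function and cancels
its linear part there. -/
theorem levyOpSplit_quadTest {N : ℕ} (η : Space N → Space N) (ν : Measure (Space N)) {δ : ℝ}
    (hδ1 : δ ≤ 1) (a : ℝ) (p x : Space N) (u : Space N → ℝ) :
    levyOpSplit η ν δ (quadTest a p x) u x =
      ∫ z in ({0}ᶜ : Set (Space N)), jetIntegrand η δ a p u x z ∂ν := by
  unfold levyOpSplit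
  congr 1
  funext z
  rw [fderiv_quadTest]
  unfold jetIntegrand
  by_cases hz : ‖z‖ < δ
  · rw [if_pos hz, if_pos hz, if_pos (hz.trans_le hδ1)]
    simp [quadTest]
  · rw [if_neg hz, if_neg hz]

theorem IsUniformLevyFamily.abs_integral_jetIntegrand_le {N : ℕ} {A : Type*} {σ K C : ℝ}
    {η : A → Space N → Space N} {ν : A → Measure (Space N)}
    (H : IsUniformLevyFamily σ K C η ν) {u : Space N → ℝ} {B : ℝ} (hB : ∀ x, |u x| ≤ B)
    {δ : ℝ} (hδ : 0 < δ) (hδ1 : δ ≤ 1) (a : ℝ) (p x : Space N) (α : A) :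
    |∫ z in ({0}ᶜ : Set (Space N)), jetIntegrand (η α) δ a p u x z ∂(ν α)| ≤
      (|a| * K ^ 2 + (2 * B + ‖p‖ * K) / δ ^ 2) * K := by
  have hK := H.pos
  have hB0 : 0 ≤ B := (abs_nonneg _).trans (hB 0)
  have hint := (integrable_min_sq (H.levy α)).const_mul
    (|a| * K ^ 2 + (2 * B + ‖p‖ * K) / δ ^ 2)
  rw [← Real.norm_eq_abs]
  refine (norm_integral_le_of_norm_le hint.integrableOn (Filter.Eventually.of_forall fun z =>
    H.abs_jetIntegrand_le hB hδ hδ1 a p x z α)).trans ?_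
  refine (setIntegral_le_integral hint (Filter.Eventually.of_forall fun z => ?_)).trans ?_
  · change 0 ≤ _ * _
    positivity
  · rw [integral_const_mul]
    gcongr
    exact integral_min_sq_le hK.le (H.levy α)

/-- A real `⨆` over an unbounded family is `0` by convention. Only with this bound does the
subsolution inequality for the supremum imply one for each control. -/
theorem IsUniformLevyFamily.bddAbove_jet {N : ℕ} {A : Type*} {σ K C : ℝ}
    {η : A → Space N → Space N} {ν : A → Measure (Space N)}
    (H : IsUniformLevyFamily σ K C η ν) {f : A → Space N → ℝ} {F : ℝ}
    (hF : ∀ α x, |f α x| ≤ F) {u : Space N → ℝ} {B : ℝ} (hB : ∀ x, |u x| ≤ B)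
    {δ : ℝ} (hδ : 0 < δ) (hδ1 : δ ≤ 1) (a : ℝ) (p x : Space N) :
    BddAbove (Set.range fun α => f α x - levyOpSplit (η α) (ν α) δ (quadTest a p x) u x) := by
  refine ⟨F + (|a| * K ^ 2 + (2 * B + ‖p‖ * K) / δ ^ 2) * K, ?_⟩
  rintro _ ⟨α, rfl⟩
  simp only [levyOpSplit_quadTest _ _ hδ1]
  linarith [(abs_le.1 (hF α x)).2,
    (abs_le.1 (H.abs_integral_jetIntegrand_le hB hδ hδ1 a p x α)).1]

theorem IsViscositySubsolution.le_of_jet {N : ℕ} {A : Type*} {σ K C l : ℝ}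
    {η : A → Space N → Space N} {ν : A → Measure (Space N)}
    (H : IsUniformLevyFamily σ K C η ν) {f : A → Space N → ℝ} {F : ℝ}
    (hF : ∀ α x, |f α x| ≤ F) {u : Space N → ℝ} {B : ℝ} (hB : ∀ x, |u x| ≤ B)
    (hu : IsViscositySubsolution l f η ν u)
    {δ : ℝ} (hδ : 0 < δ) (hδ1 : δ ≤ 1) {a : ℝ} {p x : Space N}
    (hjet : ∀ h, u (x + h) ≤ u x + inner ℝ p h + a * ‖h‖ ^ 2) (α : A) :
    l * u x + f α x ≤ ∫ z in ({0}ᶜ : Set (Space N)), jetIntegrand (η α) δ a p u x z ∂(ν α) := by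
  have h1 := hu (quadTest a p x) x δ (contDiff_quadTest a p x) hδ fun y => by
    have := hjet (y - x)
    rw [add_sub_cancel] at this
    simp only [quadTest, sub_self, inner_zero_right, norm_zero]
    linarith
  have h2 := le_ciSup (H.bddAbove_jet hF hB hδ hδ1 a p x) α
  simp only [levyOpSplit_quadTest _ _ hδ1] at h1 h2
  linarith

theorem IsViscositySupersolution.exists_le_of_jet {N : ℕ} {A : Type*} [Nonempty A] {l : ℝ}
    {η : A → Space N → Space N} {ν : A → Measure (Space N)}
    {f : A → Space N → ℝ} {u : Space N → ℝ}
    (hu : IsViscositySupersolution l f η ν u)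
    {δ : ℝ} (hδ : 0 < δ) (hδ1 : δ ≤ 1) {a : ℝ} {p x : Space N}
    (hjet : ∀ h, u x + inner ℝ p h + a * ‖h‖ ^ 2 ≤ u (x + h)) {tol : ℝ} (htol : 0 < tol) :
    ∃ α, ∫ z in ({0}ᶜ : Set (Space N)), jetIntegrand (η α) δ a p u x z ∂(ν α) ≤
      l * u x + f α x + tol := by
  have h1 := hu (quadTest a p x) x δ (contDiff_quadTest a p x) hδ fun y => by
    have := hjet (y - x)
    rw [add_sub_cancel] at this
    simp only [quadTest, sub_self, inner_zero_right, norm_zero]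
    linarith
  obtain ⟨α, hα⟩ := exists_lt_of_lt_ciSup (show - (l * u x) - tol < ⨆ α,
    (f α x - levyOpSplit (η α) (ν α) δ (quadTest a p x) u x) by linarith)
  refine ⟨α, ?_⟩
  rw [levyOpSplit_quadTest _ _ hδ1] at hα
  linarith

theorem exists_forall_le_of_le_sub_sq {V : Type*} [NormedAddCommGroup V] [ProperSpace V]
    {G : V → ℝ} (hG : Continuous G) {b c : ℝ} (hc : 0 < c) (h : ∀ v, G v ≤ b - c * ‖v‖ ^ 2) :
    ∃ v, ∀ w, G w ≤ G v := by
  refine hG.exists_forall_ge_of_isBounded 0 ?_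
  refine (isBounded_closedBall (x := (0 : V)) (r := Real.sqrt ((b - G 0) / c))).subset fun v hv => ?_
  rw [mem_closedBall_zero_iff]
  refine Real.le_sqrt_of_sq_le ?_
  rw [le_div_iff₀ hc]
  have hv' : G 0 ≤ G v := hv
  linarith [h v]

/-! ### Comparison of a solution with its translates -/

/-- The three evaluation points move independently: `t` penalizes the deviations `X`, `Y` from the
rigid configuration `w + h₁`, `w + h₂`, `w`, while `κ` confines `w` so that the maximum exists on
the whole space. -/
theorem exists_max_penalized {N : ℕ} {u : Space N → ℝ} (hu : Continuous u) {B : ℝ}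
    (hB : ∀ x, |u x| ≤ B) (h₁ h₂ : Space N) {t κ : ℝ} (ht : 0 < t) (hκ : 0 < κ) :
    ∃ X Y w : Space N, ∀ X' Y' w' : Space N,
      u (w' + h₁ + X') + u (w' + h₂ + Y') - 2 * u w'
          - t * ‖X'‖ ^ 2 - t * ‖Y'‖ ^ 2 - κ * ‖w'‖ ^ 2 ≤
        u (w + h₁ + X) + u (w + h₂ + Y) - 2 * u w
          - t * ‖X‖ ^ 2 - t * ‖Y‖ ^ 2 - κ * ‖w‖ ^ 2 := by
  let G : Space N × Space N × Space N → ℝ := fun v =>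
    u (v.2.2 + h₁ + v.1) + u (v.2.2 + h₂ + v.2.1) - 2 * u v.2.2
      - t * ‖v.1‖ ^ 2 - t * ‖v.2.1‖ ^ 2 - κ * ‖v.2.2‖ ^ 2
  have hG : Continuous G := by fun_prop
  obtain ⟨⟨X, Y, w⟩, hmax⟩ := exists_forall_le_of_le_sub_sq hG (b := 4 * B) (lt_min ht hκ)
    (fun ⟨X, Y, w⟩ => by
      have b1 := (abs_le.1 (hB (w + h₁ + X))).2
      have b2 := (abs_le.1 (hB (w + h₂ + Y))).2
      have b3 := (abs_le.1 (hB w)).1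
      have hX : 0 ≤ t * ‖X‖ ^ 2 := by positivity
      have hY : 0 ≤ t * ‖Y‖ ^ 2 := by positivity
      have hw : 0 ≤ κ * ‖w‖ ^ 2 := by positivity
      have hn : min t κ * ‖(X, Y, w)‖ ^ 2 ≤ t * ‖X‖ ^ 2 + t * ‖Y‖ ^ 2 + κ * ‖w‖ ^ 2 := by
        have hl := min_le_left t κ
        have hr := min_le_right t κ
        rw [Prod.norm_mk, Prod.norm_mk]
        rcases max_choice ‖X‖ (max ‖Y‖ ‖w‖) with h | h <;> rw [h]
        · nlinarith [mul_le_mul_of_nonneg_right hl (sq_nonneg ‖X‖)]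
        · rcases max_choice ‖Y‖ ‖w‖ with h | h <;> rw [h]
          · nlinarith [mul_le_mul_of_nonneg_right hl (sq_nonneg ‖Y‖)]
          · nlinarith [mul_le_mul_of_nonneg_right hr (sq_nonneg ‖w‖)]
      simp only [G]
      linarith)
  exact ⟨X, Y, w, fun X' Y' w' => hmax (X', Y', w')⟩

/-- Moving all three points by the same jump leaves `X` and `Y` unchanged, so `t` disappears for
`|z| ≥ δ`; this uses that `η` does not depend on the point. The gradients combine to `2 t X + 2 t Y
- 2 (t (X + Y) - κ w) = 2 κ w`, which matches the first-order term of `hjoint`. For `|z| < δ` the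
three quadratic coefficients add up to `4 t + κ`. -/
theorem IsUniformLevyFamily.jetIntegrand_combination_le {N : ℕ} {A : Type*} {σ K C : ℝ}
    {η : A → Space N → Space N} {ν : A → Measure (Space N)}
    (H : IsUniformLevyFamily σ K C η ν) {u : Space N → ℝ} {x y w X Y : Space N} {t κ : ℝ}
    (ht : 0 < t) (hκ : 0 < κ)
    (hjoint : ∀ h, u (x + h) + u (y + h) - 2 * u (w + h) ≤
      u x + u y - 2 * u w + κ * (2 * inner ℝ w h + ‖h‖ ^ 2))
    {δ : ℝ} (hδ1 : δ ≤ 1) (α : A) (z : Space N) :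
    jetIntegrand (η α) δ t ((2 * t) • X) u x z + jetIntegrand (η α) δ t ((2 * t) • Y) u y z
      - 2 * jetIntegrand (η α) δ (-(t + κ / 2)) (t • (X + Y) - κ • w) u w z ≤
    (4 * t + κ) * K ^ 2 * (ball 0 δ).indicator (fun z => ‖z‖ ^ 2) z
      + κ * (K ^ 2 + 2 * ‖w‖ * K) * min 1 (‖z‖ ^ 2) := by
  have hK := H.pos
  have hm : 0 ≤ min 1 (‖z‖ ^ 2) := by positivity
  have hη2 : ‖z‖ < 1 → ‖η α z‖ ^ 2 ≤ K ^ 2 * ‖z‖ ^ 2 := fun h => by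
    rw [← mul_pow]; exact pow_le_pow_left₀ (norm_nonneg _) (H.lin α z h) 2
  have hmin : ‖z‖ < 1 → min 1 (‖z‖ ^ 2) = ‖z‖ ^ 2 := fun h =>
    min_eq_right (pow_le_one₀ (norm_nonneg z) h.le)
  unfold jetIntegrand
  by_cases hz : ‖z‖ < δ
  · have hz1 := hz.trans_le hδ1
    simp only [if_pos hz]
    rw [Set.indicator_of_mem (by simpa using hz)]
    have h1 : (4 * t + κ) * ‖η α z‖ ^ 2 ≤ (4 * t + κ) * (K ^ 2 * ‖z‖ ^ 2) := by
      gcongr; exact hη2 hz1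
    have h2 : 0 ≤ κ * (K ^ 2 + 2 * ‖w‖ * K) * min 1 (‖z‖ ^ 2) := by positivity
    linarith
  · simp only [if_neg hz]
    rw [Set.indicator_of_notMem (by simpa using hz), mul_zero, zero_add]
    have hj := hjoint (η α z)
    by_cases hz1 : ‖z‖ < 1
    · simp only [if_pos hz1]
      rw [hmin hz1]
      simp only [inner_sub_left, inner_add_left, real_inner_smul_left]
      have h1 : κ * ‖η α z‖ ^ 2 ≤ κ * (K ^ 2 * ‖z‖ ^ 2) := by
        gcongr; exact hη2 hz1
      have h2 : 0 ≤ κ * (2 * ‖w‖ * K) * ‖z‖ ^ 2 := by positivity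
      linarith
    · simp only [if_neg hz1]
      have : min 1 (‖z‖ ^ 2) = 1 := min_eq_left (one_le_pow₀ (not_lt.1 hz1))
      rw [this]
      have h1 : inner ℝ w (η α z) ≤ ‖w‖ * K :=
        (real_inner_le_norm _ _).trans (by gcongr; exact H.bound α z)
      have h2 : ‖η α z‖ ^ 2 ≤ K ^ 2 := pow_le_pow_left₀ (norm_nonneg _) (H.bound α z) 2
      have h3 : κ * (2 * inner ℝ w (η α z) + ‖η α z‖ ^ 2) ≤ κ * (K ^ 2 + 2 * ‖w‖ * K) := by
        refine mul_le_mul_of_nonneg_left ?_ hκ.le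
        linarith
      linarith

theorem IsUniformLevyFamily.integral_combination_le {N : ℕ} {A : Type*} {σ K C : ℝ}
    {η : A → Space N → Space N} {ν : A → Measure (Space N)}
    (H : IsUniformLevyFamily σ K C η ν) {u : Space N → ℝ} (hu : Continuous u) {B : ℝ}
    (hB : ∀ x, |u x| ≤ B) {x y w X Y : Space N} {t κ : ℝ}
    (ht : 0 < t) (hκ : 0 < κ)
    (hjoint : ∀ h, u (x + h) + u (y + h) - 2 * u (w + h) ≤
      u x + u y - 2 * u w + κ * (2 * inner ℝ w h + ‖h‖ ^ 2))
    {δ : ℝ} (hδ : 0 < δ) (hδ1 : δ ≤ 1) (α : A) {tol : ℝ}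
    (htol : ∫ z, (ball 0 δ).indicator (fun z => ‖z‖ ^ 2) z ∂(ν α) ≤ tol) :
    (∫ z in ({0}ᶜ : Set (Space N)), jetIntegrand (η α) δ t ((2 * t) • X) u x z ∂(ν α))
      + (∫ z in ({0}ᶜ : Set (Space N)), jetIntegrand (η α) δ t ((2 * t) • Y) u y z ∂(ν α))
      - 2 * (∫ z in ({0}ᶜ : Set (Space N)),
          jetIntegrand (η α) δ (-(t + κ / 2)) (t • (X + Y) - κ • w) u w z ∂(ν α)) ≤
    (4 * t + κ) * K ^ 2 * tol + κ * (K ^ 2 + 2 * ‖w‖ * K) * K := by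
  have hK := H.pos
  have i1 := H.integrable_jetIntegrand hu hB hδ hδ1 t ((2 * t) • X) x α
  have i2 := H.integrable_jetIntegrand hu hB hδ hδ1 t ((2 * t) • Y) y α
  have i3 := H.integrable_jetIntegrand hu hB hδ hδ1 (-(t + κ / 2)) (t • (X + Y) - κ • w) w α
  have i4 := integrable_indicator_ball_sq (integrable_min_sq (H.levy α)) hδ1
  have i5 := (i4.const_mul ((4 * t + κ) * K ^ 2)).add
    ((integrable_min_sq (H.levy α)).const_mul (κ * (K ^ 2 + 2 * ‖w‖ * K)))
  have i12 : Integrable (fun z => jetIntegrand (η α) δ t ((2 * t) • X) u x z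
      + jetIntegrand (η α) δ t ((2 * t) • Y) u y z) (ν α) := i1.add i2
  rw [← integral_const_mul, ← integral_add i1.integrableOn i2.integrableOn,
    ← integral_sub i12.integrableOn (i3.const_mul 2).integrableOn]
  refine (integral_mono (i12.sub (i3.const_mul 2)).integrableOn i5.integrableOn
    (fun z => H.jetIntegrand_combination_le ht hκ hjoint hδ1 α z)).trans ?_
  refine (setIntegral_le_integral i5 (Filter.Eventually.of_forall fun z => ?_)).trans ?_
  · have : 0 ≤ (ball (0 : Space N) δ).indicator (fun z => ‖z‖ ^ 2) z :=
      Set.indicator_nonneg (fun _ _ => by positivity) z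
    change (0 : ℝ) ≤ (4 * t + κ) * K ^ 2 * (ball (0 : Space N) δ).indicator (fun z => ‖z‖ ^ 2) z
      + κ * (K ^ 2 + 2 * ‖w‖ * K) * min 1 (‖z‖ ^ 2)
    positivity
  · have e := integral_add (i4.const_mul ((4 * t + κ) * K ^ 2))
      ((integrable_min_sq (H.levy α)).const_mul (κ * (K ^ 2 + 2 * ‖w‖ * K)))
    refine e.le.trans ?_
    rw [integral_const_mul, integral_const_mul]
    gcongr
    exact integral_min_sq_le hK.le (H.levy α)

/-- The comparison argument, with every error proportional to `s`. In the constant, `3` is twice the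
tolerance in the choice of control plus the small-jump error, `L` accounts for moving `f` from the
maximum point to the rigid configuration, and the powers of `K` come from the localization. -/
theorem IsViscositySolution.second_difference_le_add {N : ℕ} (hN : 1 ≤ N) {A : Type*} [Nonempty A]
    {σ K C l : ℝ} (hσ : 0 < σ ∧ σ < 2) (hl : 0 < l)
    {η : A → Space N → Space N} {ν : A → Measure (Space N)}
    (H : IsUniformLevyFamily σ K C η ν) {f : A → Space N → ℝ} {F : ℝ}
    (hF : ∀ α x, |f α x| ≤ F) {L : ℝ} (hL : ∀ α x y, |f α x - f α y| ≤ L * ‖x - y‖)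
    (hL0 : 0 ≤ L)
    {u : Space N → ℝ} {B : ℝ} (hB : ∀ x, |u x| ≤ B) (hu : IsViscositySolution l f η ν u)
    {h₁ h₂ : Space N} {M : ℝ} (hM : ∀ α w, 2 * f α w - f α (w + h₁) - f α (w + h₂) ≤ M)
    (w₀ : Space N) {s : ℝ} (hs : 0 < s) (hs1 : s ≤ 1) :
    l * (u (w₀ + h₁) + u (w₀ + h₂) - 2 * u w₀) ≤
      M + s * (l * ‖w₀‖ ^ 2 + 2 * L * √(8 * B + ‖w₀‖ ^ 2) + 3 + K ^ 3
        + 2 * √(8 * B + ‖w₀‖ ^ 2) * K ^ 2) := by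
  have hK := H.pos
  have hs2 : s ^ 2 ≤ s := by nlinarith
  have hB0 : 0 ≤ B := (abs_nonneg _).trans (hB 0)
  -- With `t = s⁻²` and `κ = s²`, comparison with the point `(0, 0, w₀)` gives `|X|, |Y| ≤ s R` and
  -- `s |w| ≤ R`, so `κ |w|` is of order `s` although `w` itself may escape.
  obtain ⟨t, ht⟩ : ∃ t, t = 1 / s ^ 2 := ⟨_, rfl⟩
  have ht0 : 0 < t := by rw [ht]; positivity
  have hκ0 : 0 < s ^ 2 := by positivity
  obtain ⟨X, Y, w, hmax⟩ := exists_max_penalized hu.continuous hB h₁ h₂ ht0 hκ0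
  set R := √(8 * B + ‖w₀‖ ^ 2) with hR
  have hR0 : 0 ≤ R := Real.sqrt_nonneg _
  have hR2 : R ^ 2 = 8 * B + ‖w₀‖ ^ 2 := Real.sq_sqrt (by positivity)
  have hcmp := hmax 0 0 w₀
  simp only [add_zero, norm_zero] at hcmp
  -- size of the maximum point
  have hsize : t * ‖X‖ ^ 2 + t * ‖Y‖ ^ 2 + s ^ 2 * ‖w‖ ^ 2 ≤ R ^ 2 := by
    have b1 := abs_le.1 (hB (w₀ + h₁))
    have b2 := abs_le.1 (hB (w₀ + h₂))
    have b3 := abs_le.1 (hB w₀)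
    have b4 := abs_le.1 (hB (w + h₁ + X))
    have b5 := abs_le.1 (hB (w + h₂ + Y))
    have b6 := abs_le.1 (hB w)
    have : s ^ 2 * ‖w₀‖ ^ 2 ≤ 1 * ‖w₀‖ ^ 2 := by gcongr; linarith
    rw [hR2]
    linarith [b1.1, b2.1, b3.2, b4.2, b5.2, b6.1]
  have htX : 0 ≤ t * ‖X‖ ^ 2 := by positivity
  have htY : 0 ≤ t * ‖Y‖ ^ 2 := by positivity
  have hsw : 0 ≤ s ^ 2 * ‖w‖ ^ 2 := by positivity
  have hts : s ^ 2 * t = 1 := by rw [ht]; field_simp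
  have hX : ‖X‖ ≤ s * R := by
    refine abs_le_of_sq_le_sq' ?_ (by positivity) |>.2
    calc ‖X‖ ^ 2 = s ^ 2 * (t * ‖X‖ ^ 2) := by rw [← mul_assoc, hts, one_mul]
      _ ≤ s ^ 2 * R ^ 2 := by gcongr; linarith
      _ = _ := by ring
  have hY : ‖Y‖ ≤ s * R := by
    refine abs_le_of_sq_le_sq' ?_ (by positivity) |>.2
    calc ‖Y‖ ^ 2 = s ^ 2 * (t * ‖Y‖ ^ 2) := by rw [← mul_assoc, hts, one_mul]
      _ ≤ s ^ 2 * R ^ 2 := by gcongr; linarith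
      _ = _ := by ring
  have hw : s * ‖w‖ ≤ R := by
    refine abs_le_of_sq_le_sq' ?_ hR0 |>.2
    rw [mul_pow]; linarith
  -- jets at the maximum point
  have jx : ∀ h, u (w + h₁ + X + h) ≤
      u (w + h₁ + X) + inner ℝ ((2 * t) • X) h + t * ‖h‖ ^ 2 := fun h => by
    have := hmax (X + h) Y w
    rw [norm_add_sq_real, ← add_assoc] at this
    rw [real_inner_smul_left]
    linarith
  have jy : ∀ h, u (w + h₂ + Y + h) ≤
      u (w + h₂ + Y) + inner ℝ ((2 * t) • Y) h + t * ‖h‖ ^ 2 := fun h => by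
    have := hmax X (Y + h) w
    rw [norm_add_sq_real, ← add_assoc] at this
    rw [real_inner_smul_left]
    linarith
  -- Replacing `(X, Y, w)` by `(X - h, Y - h, w + h)` fixes the other two evaluation points and
  -- isolates the change in `-2 u(w)`; division by `2` gives the jet.
  have jw : ∀ h, u w + inner ℝ (t • (X + Y) - s ^ 2 • w) h + (-(t + s ^ 2 / 2)) * ‖h‖ ^ 2 ≤
      u (w + h) := fun h => by
    have := hmax (X - h) (Y - h) (w + h)
    rw [norm_add_sq_real, norm_sub_sq_real, norm_sub_sq_real,
      show w + h + h₁ + (X - h) = w + h₁ + X by abel,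
      show w + h + h₂ + (Y - h) = w + h₂ + Y by abel] at this
    simp only [inner_sub_left, inner_add_left, real_inner_smul_left]
    linarith
  have hjoint : ∀ h, u (w + h₁ + X + h) + u (w + h₂ + Y + h) - 2 * u (w + h) ≤
      u (w + h₁ + X) + u (w + h₂ + Y) - 2 * u w
        + s ^ 2 * (2 * inner ℝ w h + ‖h‖ ^ 2) := fun h => by
    have := hmax X Y (w + h)
    rw [norm_add_sq_real,
      show w + h + h₁ + X = w + h₁ + X + h by abel,
      show w + h + h₂ + Y = w + h₂ + Y + h by abel] at this
    linarith
  obtain ⟨δ, hδ, hδ1, -, hδs⟩ := H.exists_small_ball hN hσ one_pos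
    (s / ((4 * t + s ^ 2) * K ^ 2)) (by positivity)
  -- The supremum need not be attained, hence the tolerance `s`. The same control is used at the
  -- other two points, where the subsolution property holds for every control.
  obtain ⟨α, hα⟩ := hu.supersolution.exists_le_of_jet hδ hδ1 jw hs
  have e1 := hu.subsolution.le_of_jet H hF hB hδ hδ1 jx α
  have e2 := hu.subsolution.le_of_jet H hF hB hδ hδ1 jy α
  have e3 := H.integral_combination_le hu.continuous hB (X := X) (Y := Y) ht0 hκ0 hjoint hδ hδ1 α
    (hδs α)
  have e4 : (4 * t + s ^ 2) * K ^ 2 * (s / ((4 * t + s ^ 2) * K ^ 2)) = s := by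
    field_simp
  have e5 : s ^ 2 * (K ^ 2 + 2 * ‖w‖ * K) * K ≤ s * K ^ 3 + 2 * s * R * K ^ 2 := by
    calc s ^ 2 * (K ^ 2 + 2 * ‖w‖ * K) * K = s ^ 2 * K ^ 3 + 2 * s * (s * ‖w‖) * K ^ 2 := by ring
      _ ≤ _ := by gcongr
  have f1 := (abs_le.1 (hL α (w + h₁ + X) (w + h₁))).1
  have f2 := (abs_le.1 (hL α (w + h₂ + Y) (w + h₂))).1
  rw [add_sub_cancel_left] at f1 f2
  have f3 := hM α w
  have f4 : L * ‖X‖ ≤ L * (s * R) := by gcongr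
  have f5 : L * ‖Y‖ ≤ L * (s * R) := by gcongr
  have f6 : l * (s ^ 2 * ‖w₀‖ ^ 2) ≤ l * (s * ‖w₀‖ ^ 2) := by gcongr
  have f7 : l * (u (w₀ + h₁) + u (w₀ + h₂) - 2 * u w₀) ≤
      l * (u (w + h₁ + X) + u (w + h₂ + Y) - 2 * u w + s ^ 2 * ‖w₀‖ ^ 2) := by
    gcongr; linarith
  linarith

theorem IsViscositySolution.second_difference_le {N : ℕ} (hN : 1 ≤ N) {A : Type*} [Nonempty A]
    {σ K C l : ℝ} (hσ : 0 < σ ∧ σ < 2) (hl : 0 < l)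
    {η : A → Space N → Space N} {ν : A → Measure (Space N)}
    (H : IsUniformLevyFamily σ K C η ν) {f : A → Space N → ℝ} {F : ℝ}
    (hF : ∀ α x, |f α x| ≤ F) {L : ℝ} (hL : ∀ α x y, |f α x - f α y| ≤ L * ‖x - y‖)
    (hL0 : 0 ≤ L)
    {u : Space N → ℝ} (hu : IsViscositySolution l f η ν u)
    {h₁ h₂ : Space N} {M : ℝ} (hM : ∀ α w, 2 * f α w - f α (w + h₁) - f α (w + h₂) ≤ M)
    (w : Space N) :
    l * (u (w + h₁) + u (w + h₂) - 2 * u w) ≤ M := by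
  obtain ⟨B, hB⟩ := hu.bounded
  have hK := H.pos
  have hB0 : 0 ≤ B := (abs_nonneg _).trans (hB 0)
  set c := l * ‖w‖ ^ 2 + 2 * L * √(8 * B + ‖w‖ ^ 2) + 3 + K ^ 3
        + 2 * √(8 * B + ‖w‖ ^ 2) * K ^ 2 with hc
  have hc0 : 0 < c := by positivity
  refine le_of_forall_pos_le_add fun ε hε => ?_
  have hs : 0 < min 1 (ε / c) := lt_min one_pos (by positivity)
  refine (hu.second_difference_le_add hN hσ hl H hF hL hL0 hB hM w hs
    (min_le_left _ _)).trans ?_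
  have : min 1 (ε / c) * c ≤ ε / c * c := by gcongr; exact min_le_right _ _
  rw [div_mul_cancel₀ _ hc0.ne'] at this
  linarith

theorem IsViscositySolution.lipschitz {N : ℕ} (hN : 1 ≤ N) {A : Type*} [Nonempty A]
    {σ K C l : ℝ} (hσ : 0 < σ ∧ σ < 2) (hl : 0 < l)
    {η : A → Space N → Space N} {ν : A → Measure (Space N)}
    (H : IsUniformLevyFamily σ K C η ν) {f : A → Space N → ℝ} {F : ℝ}
    (hF : ∀ α x, |f α x| ≤ F) {L : ℝ} (hL : ∀ α x y, |f α x - f α y| ≤ L * ‖x - y‖)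
    (hL0 : 0 ≤ L)
    {u : Space N → ℝ} (hu : IsViscositySolution l f η ν u) (x y : Space N) :
    |u x - u y| ≤ L / l * ‖x - y‖ := by
  have key : ∀ x y, u x - u y ≤ L / l * ‖x - y‖ := fun x y => by
    -- With `h₂ = 0` the three-point expression based at `y` is `u x - u y`.
    have := hu.second_difference_le hN hσ hl H hF hL hL0 (h₁ := x - y) (h₂ := 0)
      (M := L * ‖x - y‖) (fun α w => by
        have := (abs_le.1 (hL α (w + (x - y)) w)).1
        rw [add_sub_cancel_left] at this
        rw [add_zero]
        linarith) y
    rw [add_zero, add_sub_cancel] at this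
    rw [div_mul_eq_mul_div, le_div_iff₀ hl]
    linarith
  rw [abs_le]
  have h := key y x
  rw [norm_sub_rev] at h
  exact ⟨by linarith, key x y⟩

theorem abs_sub_sub_fderiv_le {N : ℕ} {f : Space N → ℝ} {L β : ℝ} (hβ : 0 < β) (hL : 0 ≤ L)
    (hf : Differentiable ℝ f)
    (hf' : ∀ x y, ‖fderiv ℝ f x - fderiv ℝ f y‖ ≤ L * ‖x - y‖ ^ β) (x h : Space N) :
    |f (x + h) - f x - fderiv ℝ f x h| ≤ L * ‖h‖ ^ (1 + β) := by
  have := (convex_closedBall x ‖h‖).norm_image_sub_le_of_norm_fderiv_le' (𝕜 := ℝ) (f := f)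
    (φ := fderiv ℝ f x) (C := L * ‖h‖ ^ β) (x := x) (y := x + h) (fun y _ => hf y) (fun y hy => by
      refine (hf' y x).trans ?_
      rw [mem_closedBall, dist_eq_norm] at hy
      gcongr) (by simp) (by simp)
  rw [add_sub_cancel_left, Real.norm_eq_abs] at this
  refine this.trans_eq ?_
  rw [mul_assoc, ← Real.rpow_add_one' (norm_nonneg h) (by linarith), add_comm]

theorem IsViscositySolution.semiconcave {N : ℕ} (hN : 1 ≤ N) {A : Type*} [Nonempty A]
    {σ K C l : ℝ} (hσ : 0 < σ ∧ σ < 2) (hl : 0 < l)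
    {η : A → Space N → Space N} {ν : A → Measure (Space N)}
    (H : IsUniformLevyFamily σ K C η ν) {f : A → Space N → ℝ} {F : ℝ}
    (hF : ∀ α x, |f α x| ≤ F) {L : ℝ} (hL : ∀ α x y, |f α x - f α y| ≤ L * ‖x - y‖)
    (hL0 : 0 ≤ L) {K₁ β : ℝ} (hβ : 0 < β) (hK₁ : 0 ≤ K₁) (hf : ∀ α, Differentiable ℝ (f α))
    (hf' : ∀ α x y, ‖fderiv ℝ (f α) x - fderiv ℝ (f α) y‖ ≤ K₁ * ‖x - y‖ ^ β)
    {u : Space N → ℝ} (hu : IsViscositySolution l f η ν u) (x h : Space N) :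
    u (x + h) + u (x - h) - 2 * u x ≤ 2 * K₁ / l * ‖h‖ ^ (1 + β) := by
  have := hu.second_difference_le hN hσ hl H hF hL hL0 (h₁ := h) (h₂ := -h)
    (M := 2 * K₁ * ‖h‖ ^ (1 + β)) (fun α w => by
      have h1 := (abs_le.1 (abs_sub_sub_fderiv_le hβ hK₁ (hf α) (hf' α) w h)).1
      have h2 := (abs_le.1 (abs_sub_sub_fderiv_le hβ hK₁ (hf α) (hf' α) w (-h))).1
      rw [norm_neg, map_neg] at h2
      linarith) x
  rw [← sub_eq_add_neg] at this
  rw [div_mul_eq_mul_div, le_div_iff₀ hl]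
  linarith

/-! ### Absolute integrability of second differences -/

/-- The symmetric second difference `u(x + h) + u(x - h) - 2 u(x)`. -/
noncomputable def secondDiff {N : ℕ} (u : Space N → ℝ) (x h : Space N) : ℝ :=
  u (x + h) + u (x - h) - 2 * u x

theorem abs_secondDiff_le {N : ℕ} {u : Space N → ℝ} {B : ℝ} (hB : ∀ x, |u x| ≤ B)
    (x h : Space N) : |secondDiff u x h| ≤ 4 * B := by
  have b1 := abs_le.1 (hB (x + h))
  have b2 := abs_le.1 (hB (x - h))
  have b3 := abs_le.1 (hB x)
  rw [secondDiff, abs_le]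
  constructor <;> linarith [b1.1, b1.2, b2.1, b2.2, b3.1, b3.2]

/-- Oddness cancels the gradient `p`, so later estimates do not depend on its size. -/
theorem jetIntegrand_add_neg {N : ℕ} {η : Space N → Space N}
    (hodd : ∀ z, ‖z‖ < 1 → η (-z) = -η z) {δ a : ℝ} {p : Space N}
    {u : Space N → ℝ} {x z : Space N} (hz : ‖z‖ < 1) :
    jetIntegrand η δ a p u x z + jetIntegrand η δ a p u x (-z) =
      if ‖z‖ < δ then 2 * (a * ‖η z‖ ^ 2) else secondDiff u x (η z) := by
  unfold jetIntegrand secondDiff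
  rw [norm_neg, hodd z hz]
  split_ifs
  · rw [norm_neg]; ring
  · rw [inner_neg_right, ← sub_eq_add_neg]; ring

/-- The zero-order terms cost `l B + F`, and the jumps with `|z| ≥ 1`, where no compensator acts,
cost at most `2 B K`. The bound is independent of `a`, `p` and `δ`. -/
theorem IsViscositySubsolution.setIntegral_ball_jet_ge {N : ℕ} {A : Type*} {σ K C l : ℝ}
    (hl : 0 < l) {η : A → Space N → Space N} {ν : A → Measure (Space N)}
    (H : IsUniformLevyFamily σ K C η ν) {f : A → Space N → ℝ} {F : ℝ}
    (hF : ∀ α x, |f α x| ≤ F) {u : Space N → ℝ} (hc : Continuous u)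
    {B : ℝ} (hB : ∀ x, |u x| ≤ B)
    (hu : IsViscositySubsolution l f η ν u)
    {δ : ℝ} (hδ : 0 < δ) (hδ1 : δ ≤ 1) {a : ℝ} {p x : Space N}
    (hjet : ∀ h, u (x + h) ≤ u x + inner ℝ p h + a * ‖h‖ ^ 2) (α : A) :
    -(l * B + F + 2 * B * K) ≤
      ∫ z in ball (0 : Space N) 1, jetIntegrand (η α) δ a p u x z ∂(ν α) := by
  have hK := H.pos
  have hB0 : 0 ≤ B := (abs_nonneg _).trans (hB 0)
  have e := hu.le_of_jet H hF hB hδ hδ1 hjet α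
  have hη0 : η α 0 = 0 := by simpa using H.lin α 0 (by simp)
  have hint := H.integrable_jetIntegrand hc hB hδ hδ1 a p x α
  -- The integrand vanishes at the origin because `η α 0 = 0`, so restoring the origin changes
  -- nothing.
  rw [setIntegral_eq_integral_of_forall_compl_eq_zero (fun z hz => by
      have hz0 : z = 0 := by simpa using hz
      rw [hz0, jetIntegrand, norm_zero, if_pos hδ, hη0]; simp),
    ← integral_add_compl (measurableSet_ball (x := (0 : Space N)) (ε := 1)) hint] at e
  have hout : ∫ z in (ball (0 : Space N) 1)ᶜ, jetIntegrand (η α) δ a p u x z ∂(ν α) ≤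
      2 * B * K := by
    have hi := (integrable_min_sq (H.levy α)).const_mul (2 * B)
    refine (setIntegral_mono_on hint.integrableOn hi.integrableOn measurableSet_ball.compl
      (fun z hz => ?_)).trans ((setIntegral_le_integral hi
        (Filter.Eventually.of_forall fun z => ?_)).trans ?_)
    · have hz1 : 1 ≤ ‖z‖ := by simpa using hz
      rw [jetIntegrand, if_neg (by linarith), if_neg (by linarith),
        min_eq_left (one_le_pow₀ hz1)]
      linarith [(abs_le.1 (hB (x + η α z))).2, (abs_le.1 (hB x)).1]
    · change 0 ≤ _ * _
      positivity
    · rw [integral_const_mul]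
      gcongr
      exact integral_min_sq_le hK.le (H.levy α)
  have hlu : l * -B ≤ l * u x := by
    gcongr; exact (abs_le.1 (hB x)).1
  linarith [(abs_le.1 (hF α x)).1]

theorem integral_add_comp_neg {N : ℕ} {μ : Measure (Space N)}
    (hμ : μ.map (fun z => -z) = μ) {j : Space N → ℝ} (hj : Integrable j μ) :
    Integrable (fun z => j z + j (-z)) μ ∧ ∫ z, j z + j (-z) ∂μ = 2 * ∫ z, j z ∂μ := by
  have hmp : MeasurePreserving (fun z : Space N => -z) μ μ := ⟨measurable_neg, hμ⟩
  have hi : Integrable (fun z => j (-z)) μ := hmp.integrable_comp_of_integrable hj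
  have e : ∫ z, j (-z) ∂μ = ∫ z, j z ∂μ :=
    hmp.integral_comp (Homeomorph.neg (Space N)).measurableEmbedding j
  exact ⟨hj.add hi, by rw [integral_add hj hi, e]; ring⟩

theorem integrable_stableBall_rpow {N : ℕ} (hN : 1 ≤ N) {σ C s : ℝ} (hσ : 0 < σ) (hs : σ < s)
    (hC : 0 ≤ C) : Integrable (fun z : Space N => ‖z‖ ^ s) (stableBall N σ C) := by
  refine integrable_stableBall hC ?_
  refine (integrable_min_rpow_div hN hσ hs).integrableOn.congr_fun (fun z hz => ?_)
    measurableSet_ball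
  have hz1 : ‖z‖ < 1 := by simpa using hz
  simp only
  rw [min_eq_right (Real.rpow_le_one (norm_nonneg z) hz1.le (by linarith))]

/-- A subsolution with one-sided second difference bound of order `γ > σ` has, at every point
touched from above by a paraboloid, a two-sided integral bound. -/
theorem IsViscositySubsolution.lintegral_stableBall_le_of_jet {N : ℕ} (hN : 1 ≤ N) {A : Type*}
    {σ K C l : ℝ} (hσ : 0 < σ)
    (hl : 0 < l) {η : A → Space N → Space N} {ν : A → Measure (Space N)}
    (H : IsUniformLevyFamily σ K C η ν) {f : A → Space N → ℝ} {F : ℝ}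
    (hF : ∀ α x, |f α x| ≤ F) {u : Space N → ℝ} (hc : Continuous u)
    {B : ℝ} (hB : ∀ x, |u x| ≤ B)
    (hu : IsViscositySubsolution l f η ν u)
    {D γ : ℝ} (hγ : σ < γ) (hD : 0 ≤ D) (hsc : ∀ x h, secondDiff u x h ≤ D * ‖h‖ ^ γ)
    {α : A} (hsymm : ((ν α).restrict (ball 0 1)).map (fun z => -z) = (ν α).restrict (ball 0 1))
    (hodd : ∀ z, ‖z‖ < 1 → η α (-z) = -η α z)
    {c : ℝ} (hc_low : stableBall N σ c ≤ (ν α).restrict (ball 0 1))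
    {δ : ℝ} (hδ : 0 < δ) (hδ1 : δ ≤ 1) {a : ℝ} (ha : 0 ≤ a) {p x : Space N}
    (hδa : 2 * a * K ^ 2 * ∫ z, (ball 0 δ).indicator (fun z => ‖z‖ ^ 2) z ∂(ν α) ≤ 1)
    (hjet : ∀ h, u (x + h) ≤ u x + inner ℝ p h + a * ‖h‖ ^ 2) :
    ∫⁻ z, (ball 0 δ)ᶜ.indicator
        (fun z => ENNReal.ofReal (D * (K * ‖z‖) ^ γ - secondDiff u x (η α z))) z
        ∂(stableBall N σ c) ≤
      ENNReal.ofReal (∫ z, D * (K * ‖z‖) ^ γ ∂(stableBall N σ C)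
        + 1 + 2 * (l * B + F + 2 * B * K)) := by
  have hK := H.pos
  set μ := (ν α).restrict (ball (0 : Space N) 1) with hμ
  set P : Space N → ℝ := fun z => D * (K * ‖z‖) ^ γ with hPdef
  have hP0 : ∀ z, 0 ≤ P z := fun z => by simp only [P]; positivity
  have hPs : Integrable P (stableBall N σ C) := by
    refine ((integrable_stableBall_rpow hN hσ hγ H.const_nonneg).const_mul (D * K ^ γ)).congr
      (Filter.Eventually.of_forall fun z => ?_)
    simp only [P]
    rw [Real.mul_rpow hK.le (norm_nonneg z)]; ring
  have hPμ : Integrable P μ := hPs.mono_measure (H.upper α)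
  have hPle : ∫ z, P z ∂μ ≤ ∫ z, P z ∂(stableBall N σ C) :=
    integral_mono_measure (H.upper α) (Filter.Eventually.of_forall hP0) hPs
  have hsP : ∀ z, ‖z‖ < 1 → secondDiff u x (η α z) ≤ P z := fun z hz => by
    refine (hsc x _).trans ?_
    simp only [P]
    gcongr
    · linarith
    · exact H.lin α z hz
  have hint := (H.integrable_jetIntegrand hc hB hδ hδ1 a p x α).integrableOn (s := ball 0 1)
  obtain ⟨hi, he⟩ := integral_add_comp_neg hsymm hint
  have hlow := hu.setIntegral_ball_jet_ge hl H hF hc hB hδ hδ1 hjet α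
  have hI := integrable_indicator_ball_sq (integrable_min_sq (H.levy α)) hδ1
  have hI0 : ∀ z, 0 ≤ (ball (0 : Space N) δ).indicator (fun z => ‖z‖ ^ 2) z := fun z =>
    Set.indicator_nonneg (fun _ _ => by positivity) z
  have hIμ : 2 * a * K ^ 2 * ∫ z, (ball (0 : Space N) δ).indicator (fun z => ‖z‖ ^ 2) z ∂μ ≤ 1 := by
    refine le_trans ?_ hδa
    exact mul_le_mul_of_nonneg_left
      (setIntegral_le_integral hI (Filter.Eventually.of_forall hI0)) (by positivity)
  -- `P` dominates the second difference, and the added quadratic term absorbs the paraboloid for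
  -- `|z| < δ`. Hence `Q ≥ 0` on the unit ball, and `Q` is the desired integrand outside the
  -- `δ`-ball.
  set Q : Space N → ℝ := fun z => P z
    + 2 * a * K ^ 2 * (ball (0 : Space N) δ).indicator (fun z => ‖z‖ ^ 2) z
    - (jetIntegrand (η α) δ a p u x z + jetIntegrand (η α) δ a p u x (-z)) with hQ
  have hPI : Integrable (fun z => P z
    + 2 * a * K ^ 2 * (ball (0 : Space N) δ).indicator (fun z => ‖z‖ ^ 2) z) μ :=
    hPμ.add (hI.integrableOn.const_mul _)
  have hQi : Integrable Q μ := hPI.sub hi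
  have hQint : ∫ z, Q z ∂μ ≤ ∫ z, P z ∂(stableBall N σ C)
        + 1 + 2 * (l * B + F + 2 * B * K) := by
    simp only [Q]
    rw [integral_sub hPI hi, integral_add hPμ (hI.integrableOn.const_mul _), he,
      integral_const_mul (2 * a * K ^ 2)]
    linarith
  have hball : ∀ᵐ z ∂μ, ‖z‖ < 1 := by
    filter_upwards [ae_restrict_mem (measurableSet_ball (x := (0 : Space N)) (ε := 1))] with z hz
    simpa using hz
  have hQ_eq : ∀ z, ‖z‖ < 1 → 0 ≤ Q z ∧ (ball 0 δ)ᶜ.indicator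
      (fun z => ENNReal.ofReal (P z - secondDiff u x (η α z))) z ≤ ENNReal.ofReal (Q z) := by
    intro z hz1
    simp only [Q]
    rw [jetIntegrand_add_neg hodd hz1]
    by_cases hz : ‖z‖ < δ
    · have hz' : z ∈ ball (0 : Space N) δ := by simpa using hz
      rw [if_pos hz, Set.indicator_of_mem hz', Set.indicator_of_notMem (by simpa using hz)]
      refine ⟨?_, zero_le⟩
      have h1 : a * ‖η α z‖ ^ 2 ≤ a * (K * ‖z‖) ^ 2 := by
        gcongr; exact H.lin α z hz1
      linarith [hP0 z]
    · have hz' : z ∉ ball (0 : Space N) δ := by simpa using hz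
      rw [if_neg hz, Set.indicator_of_notMem hz', Set.indicator_of_mem (by simpa using hz)]
      refine ⟨by linarith [hsP z hz1], le_of_eq ?_⟩
      congr 1; ring
  -- Nondegeneracy enters here: the integrand is nonnegative, so the stable measure may be replaced
  -- by the larger measure of the control.
  refine (lintegral_mono' hc_low le_rfl).trans ?_
  refine (lintegral_mono_ae (g := fun z => ENNReal.ofReal (Q z))
    (hball.mono fun z hz => (hQ_eq z hz).2)).trans ?_
  rw [← ofReal_integral_eq_lintegral_ofReal hQi (hball.mono fun z hz => (hQ_eq z hz).1)]
  exact ENNReal.ofReal_le_ofReal hQint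

/-- A maximum point of `u - a |· - x₀|²` is touched from above by a paraboloid and tends to `x₀` as
`a → ∞`; such points are therefore dense. -/
theorem exists_jet_near {N : ℕ} {u : Space N → ℝ} (hu : Continuous u) {B : ℝ}
    (hB : ∀ x, |u x| ≤ B) (x₀ : Space N) {a : ℝ} (ha : 0 < a) :
    ∃ x p : Space N, a * ‖x - x₀‖ ^ 2 ≤ 2 * B ∧
      ∀ h, u (x + h) ≤ u x + inner ℝ p h + a * ‖h‖ ^ 2 := by
  obtain ⟨v, hv⟩ := exists_forall_le_of_le_sub_sq
    (G := fun v : Space N => u (x₀ + v) - a * ‖v‖ ^ 2) (by fun_prop) (b := B) ha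
    (fun v => by linarith [(abs_le.1 (hB (x₀ + v))).2])
  refine ⟨x₀ + v, (2 * a) • v, ?_, fun h => ?_⟩
  · have := hv 0
    simp only [norm_zero, add_zero] at this
    rw [add_sub_cancel_left]
    linarith [(abs_le.1 (hB (x₀ + v))).2, (abs_le.1 (hB x₀)).1]
  · have := hv (v + h)
    rw [norm_add_sq_real, ← add_assoc] at this
    rw [real_inner_smul_left]
    linarith

/-- The bound at touched points does not depend on the opening of the paraboloid. It passes to an
arbitrary point by Fatou as the opening tends to infinity, with `δ` shrinking fast enough to keep
the paraboloid's contribution at most `1`. -/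
theorem IsViscositySubsolution.lintegral_stableBall_le {N : ℕ} (hN : 1 ≤ N) {A : Type*}
    {σ K C l : ℝ} (hσ : 0 < σ ∧ σ < 2)
    (hl : 0 < l) {η : A → Space N → Space N} {ν : A → Measure (Space N)}
    (H : IsUniformLevyFamily σ K C η ν) {f : A → Space N → ℝ} {F : ℝ}
    (hF : ∀ α x, |f α x| ≤ F) {u : Space N → ℝ} (hc : Continuous u)
    {B : ℝ} (hB : ∀ x, |u x| ≤ B)
    (hu : IsViscositySubsolution l f η ν u)
    {D γ : ℝ} (hγ : σ < γ) (hD : 0 ≤ D) (hsc : ∀ x h, secondDiff u x h ≤ D * ‖h‖ ^ γ)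
    {α : A} (hsymm : ((ν α).restrict (ball 0 1)).map (fun z => -z) = (ν α).restrict (ball 0 1))
    (hodd : ∀ z, ‖z‖ < 1 → η α (-z) = -η α z)
    {c : ℝ} (hc_low : stableBall N σ c ≤ (ν α).restrict (ball 0 1)) (x₀ : Space N) :
    ∫⁻ z, ENNReal.ofReal (D * (K * ‖z‖) ^ γ - secondDiff u x₀ (η α z)) ∂(stableBall N σ c) ≤
      ENNReal.ofReal (∫ z, D * (K * ‖z‖) ^ γ ∂(stableBall N σ C)
        + 1 + 2 * (l * B + F + 2 * B * K)) := by
  have hK := H.pos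
  have hη := H.continuous α
  have hstep : ∀ n : ℕ, ∃ x : Space N, ∃ δ : ℝ, ‖x - x₀‖ ^ 2 ≤ 2 * B * (1 / ((n : ℝ) + 1)) ∧
      δ ≤ 1 / ((n : ℝ) + 1) ∧
      ∫⁻ z, (ball 0 δ)ᶜ.indicator
        (fun z => ENNReal.ofReal (D * (K * ‖z‖) ^ γ - secondDiff u x (η α z))) z
        ∂(stableBall N σ c) ≤
      ENNReal.ofReal (∫ z, D * (K * ‖z‖) ^ γ ∂(stableBall N σ C)
        + 1 + 2 * (l * B + F + 2 * B * K)) := fun n => by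
    have hn : (0 : ℝ) < n + 1 := by positivity
    obtain ⟨x, p, hx, hjet⟩ := exists_jet_near hc hB x₀ hn
    obtain ⟨δ, hδ, hδ1, hδn, hδt⟩ := H.exists_small_ball hN hσ
      (r := 1 / ((n : ℝ) + 1)) (by positivity) (1 / (2 * ((n : ℝ) + 1) * K ^ 2)) (by positivity)
    refine ⟨x, δ, ?_, hδn, hu.lintegral_stableBall_le_of_jet hN hσ.1 hl H hF hc hB hγ hD hsc hsymm
      hodd hc_low hδ hδ1 hn.le ?_ hjet⟩
    · rw [mul_one_div, le_div_iff₀ hn]; linarith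
    · calc _ ≤ 2 * ((n : ℝ) + 1) * K ^ 2 * (1 / (2 * ((n : ℝ) + 1) * K ^ 2)) := by
            gcongr; exact hδt α
        _ = 1 := by field_simp
  choose x δ hx hδ hle using hstep
  have hxlim : Filter.Tendsto x Filter.atTop (nhds x₀) := by
    rw [tendsto_iff_norm_sub_tendsto_zero]
    have h0 : Filter.Tendsto (fun n : ℕ => 2 * B * (1 / ((n : ℝ) + 1))) Filter.atTop (nhds 0) := by
      simpa using (tendsto_one_div_add_atTop_nhds_zero_nat (𝕜 := ℝ)).const_mul (2 * B)
    have h1 := squeeze_zero (fun n => by positivity) hx h0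
    have h2 := h1.sqrt
    simpa [Real.sqrt_sq] using h2
  refine (lintegral_mono (g := fun z => Filter.liminf (fun n => (ball 0 (δ n))ᶜ.indicator
        (fun z => ENNReal.ofReal (D * (K * ‖z‖) ^ γ - secondDiff u (x n) (η α z))) z)
        Filter.atTop) fun z => ?_).trans
    ((lintegral_liminf_le fun n => ?_).trans ?_)
  -- The origin may lie in every excised ball, so convergence of the indicators is unavailable
  -- there; the limiting integrand vanishes instead.
  · by_cases hz : z = 0
    · have hη0 : η α 0 = 0 := by simpa using H.lin α 0 (by simp)
      have : D * (K * ‖z‖) ^ γ - secondDiff u x₀ (η α z) = 0 := by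
        rw [hz, hη0, norm_zero, mul_zero, Real.zero_rpow (by linarith [hσ.1]), secondDiff,
          add_zero, sub_zero]
        ring
      rw [this, ENNReal.ofReal_zero]
      exact zero_le
    · refine le_of_eq (Filter.Tendsto.liminf_eq ?_).symm
      have hlim : Filter.Tendsto (fun n => ENNReal.ofReal
          (D * (K * ‖z‖) ^ γ - secondDiff u (x n) (η α z))) Filter.atTop
          (nhds (ENNReal.ofReal (D * (K * ‖z‖) ^ γ - secondDiff u x₀ (η α z)))) := by
        refine ENNReal.tendsto_ofReal (Filter.Tendsto.const_sub _ ?_)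
        have hcont : Continuous fun y => secondDiff u y (η α z) := by
          unfold secondDiff; fun_prop
        exact (hcont.tendsto x₀).comp hxlim
      refine hlim.congr' ?_
      obtain ⟨n, hn⟩ := exists_nat_one_div_lt (norm_pos_iff.2 hz)
      filter_upwards [Filter.eventually_ge_atTop n] with m hm
      rw [Set.indicator_of_mem]
      rw [Set.mem_compl_iff, mem_ball_zero_iff, not_lt]
      exact (hδ m).trans ((Nat.one_div_le_one_div hm).trans hn.le)
  · refine Measurable.indicator ?_ measurableSet_ball.compl
    refine ENNReal.measurable_ofReal.comp (Measurable.sub ?_ ?_)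
    · fun_prop
    · unfold secondDiff
      exact (by fun_prop : Continuous _).measurable
  · refine (Filter.liminf_le_liminf (Filter.Eventually.of_forall hle)).trans ?_
    simp

/-- The one-sided bound `P` gives `|secondDiff u x k| ≤ (P - secondDiff u x k) + P`, and the
Lipschitz bound pays `2 L |k - h|` for changing the jump. It is used with `k = η z` and `h = z`. -/
theorem abs_secondDiff_le_of_lipschitz {N : ℕ} {u : Space N → ℝ} {L : ℝ}
    (hL : ∀ x y, |u x - u y| ≤ L * ‖x - y‖) {x h k : Space N} {P : ℝ} (hP : 0 ≤ P)
    (hk : secondDiff u x k ≤ P) :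
    |secondDiff u x h| ≤ (P - secondDiff u x k) + P + 2 * L * ‖k - h‖ := by
  have h1 := abs_le.1 (hL (x + k) (x + h))
  have h2 := abs_le.1 (hL (x - k) (x - h))
  rw [add_sub_add_left_eq_sub] at h1
  rw [sub_sub_sub_cancel_left, norm_sub_rev] at h2
  unfold secondDiff at *
  rw [abs_le]
  constructor <;> linarith [h1.1, h1.2, h2.1, h2.2]

theorem lintegral_secondDiff_kernel_le {N : ℕ} (hN : 1 ≤ N) {σ c : ℝ} (hσ : 0 < σ ∧ σ < 2)
    (hc : 0 < c) {u : Space N → ℝ} (hu : Continuous u) {B : ℝ} (hB : ∀ x, |u x| ≤ B)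
    {M : ℝ} (hM : ∀ x, ∫⁻ z, ENNReal.ofReal |secondDiff u x z| ∂(stableBall N σ c) ≤
      ENNReal.ofReal M) :
    ∃ M' : ℝ, 0 ≤ M' ∧ ∀ x,
      ∫⁻ z, ENNReal.ofReal |secondDiff u x z / ‖z‖ ^ ((N : ℝ) + σ)| ≤ ENNReal.ofReal M' := by
  have hB0 : 0 ≤ B := (abs_nonneg _).trans (hB 0)
  have hi := (integrable_min_sq_div hN hσ).const_mul (4 * B)
  set T := ∫ z : Space N, 4 * B * (min 1 (‖z‖ ^ 2) / ‖z‖ ^ ((N : ℝ) + σ)) with hT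
  have hT0 : 0 ≤ T := integral_nonneg fun z => by positivity
  refine ⟨max M 0 / c + T, by positivity, fun x => ?_⟩
  have hmeas : Measurable fun z => ENNReal.ofReal |secondDiff u x z| := by
    unfold secondDiff
    exact ENNReal.measurable_ofReal.comp (by fun_prop : Continuous _).measurable
  have hk : Measurable fun z : Space N => ENNReal.ofReal (c / ‖z‖ ^ ((N : ℝ) + σ)) := by fun_prop
  rw [← lintegral_add_compl _ (measurableSet_ball (x := (0 : Space N)) (ε := 1)),
    ENNReal.ofReal_add (by positivity) hT0]
  refine add_le_add ?_ ?_
  · have h := hM x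
    rw [stableBall, lintegral_withDensity_eq_lintegral_mul _ hk hmeas] at h
    have e : ∀ z : Space N, ENNReal.ofReal |secondDiff u x z / ‖z‖ ^ ((N : ℝ) + σ)| =
        ENNReal.ofReal (1 / c) * (ENNReal.ofReal (c / ‖z‖ ^ ((N : ℝ) + σ)) *
          ENNReal.ofReal |secondDiff u x z|) := fun z => by
      rw [← ENNReal.ofReal_mul (by positivity), ← ENNReal.ofReal_mul (by positivity), abs_div,
        abs_of_nonneg (by positivity : 0 ≤ ‖z‖ ^ ((N : ℝ) + σ))]
      congr 1
      field_simp
    simp only [e]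
    have e' := lintegral_const_mul (μ := volume.restrict (ball (0 : Space N) 1))
      (ENNReal.ofReal (1 / c)) (hk.mul hmeas)
    simp only [Pi.mul_apply] at e' h
    rw [e']
    calc _ ≤ ENNReal.ofReal (1 / c) * ENNReal.ofReal M := by gcongr
      _ ≤ ENNReal.ofReal (1 / c) * ENNReal.ofReal (max M 0) := by
        gcongr; exact le_max_left _ _
      _ = _ := by
        rw [← ENNReal.ofReal_mul (by positivity)]; congr 1; ring
  · rw [hT, ofReal_integral_eq_lintegral_ofReal hi
      (Filter.Eventually.of_forall fun z => by positivity)]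
    refine le_trans ?_ (setLIntegral_le_lintegral (ball (0 : Space N) 1)ᶜ _)
    refine setLIntegral_mono' measurableSet_ball.compl fun z hz => ENNReal.ofReal_le_ofReal ?_
    have hz1 : 1 ≤ ‖z‖ := by simpa using hz
    rw [min_eq_left (one_le_pow₀ hz1), abs_div,
      abs_of_nonneg (by positivity : 0 ≤ ‖z‖ ^ ((N : ℝ) + σ)), mul_one_div]
    gcongr
    exact abs_secondDiff_le hB x z

theorem ae_stableBall_norm_lt_one {N : ℕ} {σ c : ℝ} : ∀ᵐ z ∂(stableBall N σ c), ‖z‖ < 1 := by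
  refine (withDensity_absolutelyContinuous _ _).ae_le ?_
  filter_upwards [ae_restrict_mem (measurableSet_ball (x := (0 : Space N)) (ε := 1))] with z hz
  simpa using hz

/-- Replacing `η z` by `z` costs a multiple of `|z|²`, which the kernel integrates because `σ < 2`.
-/
theorem exists_lintegral_secondDiff_le {N : ℕ} (hN : 1 ≤ N) {σ c : ℝ} (hσ : 0 < σ ∧ σ < 2)
    (hc : 0 < c) {u : Space N → ℝ} (hu : Continuous u)
    {L : ℝ} (hL0 : 0 ≤ L) (hL : ∀ x y, |u x - u y| ≤ L * ‖x - y‖)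
    {D K γ : ℝ} (hγ : σ < γ) (hD : 0 ≤ D) (hK : 0 ≤ K)
    (hsc : ∀ x h, secondDiff u x h ≤ D * ‖h‖ ^ γ)
    {η : Space N → Space N} (hη : Continuous η) (hlin : ∀ z, ‖z‖ < 1 → ‖η z‖ ≤ K * ‖z‖)
    {K₀ : ℝ} (hK₀ : 0 ≤ K₀) (hη_id : ∀ z, ‖z‖ < 1 → ‖η z - z‖ ≤ K₀ * ‖z‖ ^ 2)
    {M : ℝ} (hM : ∀ x, ∫⁻ z, ENNReal.ofReal (D * (K * ‖z‖) ^ γ - secondDiff u x (η z))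
      ∂(stableBall N σ c) ≤ ENNReal.ofReal M) :
    ∃ M' : ℝ, ∀ x, ∫⁻ z, ENNReal.ofReal |secondDiff u x z| ∂(stableBall N σ c) ≤
      ENNReal.ofReal M' := by
  have hQ : Integrable (fun z => D * (K * ‖z‖) ^ γ + 2 * L * (K₀ * ‖z‖ ^ (2 : ℝ)))
      (stableBall N σ c) := by
    refine (((integrable_stableBall_rpow hN hσ.1 hγ hc.le).const_mul (D * K ^ γ)).add
      ((integrable_stableBall_rpow hN hσ.1 hσ.2 hc.le).const_mul (2 * L * K₀))).congr
      (Filter.Eventually.of_forall fun z => ?_)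
    simp only [Pi.add_apply]
    rw [Real.mul_rpow hK (norm_nonneg z)]; ring
  have hQ0 : ∀ z : Space N, 0 ≤ D * (K * ‖z‖) ^ γ + 2 * L * (K₀ * ‖z‖ ^ (2 : ℝ)) := fun z => by
    positivity
  -- `M` is not assumed nonnegative, and `ENNReal.ofReal` is additive only on nonnegative reals.
  refine ⟨max M 0 + ∫ z, D * (K * ‖z‖) ^ γ + 2 * L * (K₀ * ‖z‖ ^ (2 : ℝ)) ∂(stableBall N σ c),
    fun x => ?_⟩
  rw [ENNReal.ofReal_add (le_max_right _ _) (integral_nonneg hQ0),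
    ofReal_integral_eq_lintegral_ofReal hQ (Filter.Eventually.of_forall hQ0)]
  have hmeas : Measurable fun z => ENNReal.ofReal (D * (K * ‖z‖) ^ γ - secondDiff u x (η z)) := by
    refine ENNReal.measurable_ofReal.comp (Measurable.sub (by fun_prop) ?_)
    unfold secondDiff
    exact (by fun_prop : Continuous _).measurable
  refine le_trans ?_ (add_le_add ((hM x).trans (ENNReal.ofReal_le_ofReal (le_max_left M 0))) le_rfl)
  rw [← lintegral_add_left hmeas]
  refine lintegral_mono_ae (ae_stableBall_norm_lt_one.mono fun z hz => ?_)
  have hP : 0 ≤ D * (K * ‖z‖) ^ γ := by positivity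
  have hk : secondDiff u x (η z) ≤ D * (K * ‖z‖) ^ γ := by
    refine (hsc x _).trans ?_
    gcongr
    · linarith [hσ.1]
    · exact hlin z hz
  rw [← ENNReal.ofReal_add (by linarith) (hQ0 z)]
  refine ENNReal.ofReal_le_ofReal ((abs_secondDiff_le_of_lipschitz hL hP hk).trans ?_)
  have h1 : 2 * L * ‖η z - z‖ ≤ 2 * L * (K₀ * ‖z‖ ^ 2) := by
    gcongr; exact hη_id z hz
  rw [Real.rpow_two]
  linarith

/-! ### Representation of the fractional Laplacian -/

theorem exists_taylor_bound {N : ℕ} {φ : Space N → ℝ} (hφ : ContDiff ℝ ∞ φ)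
    (hs : HasCompactSupport φ) :
    ∃ L : ℝ, 0 ≤ L ∧ ∀ x h, |φ (x + h) - φ x - fderiv ℝ φ x h| ≤ L * ‖h‖ ^ 2 := by
  have h1 : ContDiff ℝ 1 (fderiv ℝ φ) := hφ.fderiv_right (m := 1) (by norm_cast)
  obtain ⟨L, hL⟩ := ContDiff.lipschitzWith_of_hasCompactSupport (hs.fderiv ℝ) h1 one_ne_zero
  refine ⟨L, L.2, fun x h => ?_⟩
  have := abs_sub_sub_fderiv_le one_pos L.2 (hφ.differentiable (by simp))
    (fun x y => by simpa [dist_eq_norm] using hL.dist_le_mul x y) x h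
  rwa [one_add_one_eq_two, Real.rpow_two] at this

theorem exists_abs_le {N : ℕ} {φ : Space N → ℝ} (hφ : Continuous φ)
    (hs : HasCompactSupport φ) : ∃ B : ℝ, ∀ x, |φ x| ≤ B :=
  hs.exists_bound_of_continuous hφ

/-- Averaging the absolutely convergent integral over `z` and `-z` removes the compensator. -/
theorem fracLaplacian_eq_secondDiff {N : ℕ} (hN : 1 ≤ N) {σ : ℝ} (hσ : 0 < σ ∧ σ < 2)
    {φ : Space N → ℝ} (hφ : ContDiff ℝ ∞ φ) (hs : HasCompactSupport φ) (x : Space N) :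
    fracLaplacian σ φ x = -(fracLaplacianConst N σ / 2) *
      ∫ z, secondDiff φ x z / ‖z‖ ^ ((N : ℝ) + σ) := by
  obtain ⟨L, hL0, hL⟩ := exists_taylor_bound hφ hs
  obtain ⟨B, hB⟩ := exists_abs_le hφ.continuous hs
  have hB0 : 0 ≤ B := (abs_nonneg _).trans (hB 0)
  set c := fracLaplacianConst N σ
  let J : Space N → ℝ := fun z => (φ (x + z) - φ x - (if ‖z‖ < 1 then fderiv ℝ φ x z else 0)) *
    (c / ‖z‖ ^ ((N : ℝ) + σ))
  have hφc := hφ.continuous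
  have hJ : Integrable J volume := by
    refine ((integrable_min_sq_div hN hσ).const_mul ((L + 2 * B) * |c|)).mono' ?_
      (Filter.Eventually.of_forall fun z => ?_)
    · refine (Measurable.mul (Measurable.sub (by fun_prop : Continuous _).measurable ?_)
        (by fun_prop)).aestronglyMeasurable
      exact Measurable.ite (measurableSet_lt (by fun_prop) (by fun_prop))
        (fderiv ℝ φ x).continuous.measurable measurable_const
    · have hk : 0 ≤ ‖z‖ ^ ((N : ℝ) + σ) := by positivity
      have key : |φ (x + z) - φ x - (if ‖z‖ < 1 then fderiv ℝ φ x z else 0)| ≤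
          (L + 2 * B) * min 1 (‖z‖ ^ 2) := by
        split_ifs with hz
        · rw [min_eq_right (pow_le_one₀ (norm_nonneg z) hz.le)]
          refine (hL x z).trans ?_
          gcongr
          linarith
        · rw [min_eq_left (one_le_pow₀ (not_lt.1 hz)), sub_zero, mul_one]
          have b1 := abs_le.1 (hB (x + z))
          have b2 := abs_le.1 (hB x)
          rw [abs_le]
          constructor <;> linarith [b1.1, b1.2, b2.1, b2.2]
      simp only [J]
      rw [Real.norm_eq_abs, abs_mul, abs_div, abs_of_nonneg hk]
      calc _ ≤ (L + 2 * B) * min 1 (‖z‖ ^ 2) * (|c| / ‖z‖ ^ ((N : ℝ) + σ)) := by gcongr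
        _ = _ := by ring
  have h := (integral_add_comp_neg (Measure.map_neg_eq_self volume) hJ).2
  have e : ∀ z, J z + J (-z) = c * (secondDiff φ x z / ‖z‖ ^ ((N : ℝ) + σ)) := fun z => by
    simp only [J, secondDiff, norm_neg, map_neg, ← sub_eq_add_neg]
    split_ifs <;> ring
  simp only [e] at h
  rw [integral_const_mul] at h
  change -(∫ z, J z) = _
  linarith

theorem continuous_secondDiff {N : ℕ} {u : Space N → ℝ} (hu : Continuous u) :
    Continuous fun p : Space N × Space N => secondDiff u p.1 p.2 := by
  unfold secondDiff; fun_prop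

theorem integrable_secondDiff {N : ℕ} {φ : Space N → ℝ} (hφ : Integrable φ volume)
    (z : Space N) : Integrable (fun x => secondDiff φ x z) volume :=
  ((hφ.comp_add_right z).add (hφ.comp_sub_right z)).sub (hφ.const_mul 2)

/-- For fixed `z`, translation invariance of Lebesgue measure makes the second difference
self-adjoint. -/
theorem integral_mul_secondDiff_comm {N : ℕ} {u φ : Space N → ℝ} (hu : Continuous u) {B : ℝ}
    (hB : ∀ x, |u x| ≤ B) (hφ : Integrable φ volume) (z : Space N) :
    ∫ x, u x * secondDiff φ x z = ∫ x, φ x * secondDiff u x z := by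
  have hb : ∀ {v w : Space N → ℝ}, Continuous v → (∀ x, |v x| ≤ B) → Integrable w volume →
      Integrable (fun x => v x * w x) volume := fun hv hvB hw =>
    hw.bdd_mul hv.aestronglyMeasurable (Filter.Eventually.of_forall hvB)
  have i1 := hb hu hB (hφ.comp_add_right z)
  have i2 := hb hu hB (hφ.comp_sub_right z)
  have i3 := hb hu hB hφ
  have j1 := hb (v := fun x => u (x + z)) (by fun_prop) (fun x => hB _) hφ
  have j2 := hb (v := fun x => u (x - z)) (by fun_prop) (fun x => hB _) hφ
  have e1 : ∫ x, u x * φ (x + z) = ∫ x, u (x - z) * φ x := by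
    simpa using integral_add_right_eq_self (μ := volume) (fun x => u (x - z) * φ x) z
  have e2 : ∫ x, u x * φ (x - z) = ∫ x, u (x + z) * φ x := by
    simpa using integral_sub_right_eq_self (μ := volume) (fun x => u (x + z) * φ x) z
  calc ∫ x, u x * secondDiff φ x z
      = ∫ x, (u x * φ (x + z) + u x * φ (x - z)) - 2 * (u x * φ x) := by
        congr 1; funext x; unfold secondDiff; ring
    _ = (∫ x, u x * φ (x + z)) + (∫ x, u x * φ (x - z)) - 2 * ∫ x, u x * φ x := by
        rw [integral_sub (by exact i1.add i2) (i3.const_mul 2), integral_add i1 i2,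
          integral_const_mul]
    _ = (∫ x, u (x + z) * φ x) + (∫ x, u (x - z) * φ x) - 2 * ∫ x, u x * φ x := by
        rw [e1, e2]; ring
    _ = ∫ x, (u (x + z) * φ x + u (x - z) * φ x) - 2 * (u x * φ x) := by
        rw [integral_sub (by exact j1.add j2) (i3.const_mul 2), integral_add j1 j2,
          integral_const_mul]
    _ = _ := by congr 1; funext x; unfold secondDiff; ring

/-- Since `u` is only bounded, Fubini on the test side needs an `L¹` bound in `x`. For `|z| < 1` it
follows from Taylor's formula on the support enlarged by `1`, otherwise from translation invariance
of the `L¹` norm. -/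
theorem exists_integral_abs_secondDiff_le {N : ℕ} {φ : Space N → ℝ} (hφ : ContDiff ℝ ∞ φ)
    (hs : HasCompactSupport φ) :
    ∃ D : ℝ, ∀ z, ∫ x, |secondDiff φ x z| ≤ D * min 1 (‖z‖ ^ 2) := by
  obtain ⟨L, hL0, hL⟩ := exists_taylor_bound hφ hs
  have hi : Integrable φ volume := hφ.continuous.integrable_of_hasCompactSupport hs
  obtain ⟨R, hR⟩ := hs.isCompact.isBounded.subset_closedBall (0 : Space N)
  set V := (volume : Measure (Space N)).real (closedBall 0 (R + 1)) with hV
  have hV0 : 0 ≤ V := measureReal_nonneg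
  have hI0 : 0 ≤ ∫ x, |φ x| := integral_nonneg fun x => abs_nonneg _
  have hzero : ∀ y, R < ‖y‖ → φ y = 0 := fun y hy => by
    by_contra h
    have := hR (subset_tsupport φ h)
    rw [mem_closedBall_zero_iff] at this
    linarith
  refine ⟨2 * L * V + 4 * ∫ x, |φ x|, fun z => ?_⟩
  by_cases hz : ‖z‖ < 1
  · rw [min_eq_right (pow_le_one₀ (norm_nonneg z) hz.le)]
    have hle : ∀ x, |secondDiff φ x z| ≤
        (closedBall (0 : Space N) (R + 1)).indicator (fun _ => 2 * L * ‖z‖ ^ 2) x := fun x => by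
      by_cases hx : x ∈ closedBall (0 : Space N) (R + 1)
      · rw [Set.indicator_of_mem hx]
        have h1 := abs_le.1 (hL x z)
        have h2 := abs_le.1 (hL x (-z))
        rw [norm_neg, map_neg, ← sub_eq_add_neg] at h2
        rw [secondDiff, abs_le]
        constructor <;> linarith [h1.1, h1.2, h2.1, h2.2]
      · rw [Set.indicator_of_notMem hx]
        rw [mem_closedBall_zero_iff, not_le] at hx
        have n1 : ‖x‖ ≤ ‖x + z‖ + ‖z‖ := by simpa using norm_sub_le (x + z) z
        have n2 : ‖x‖ ≤ ‖x - z‖ + ‖z‖ := by simpa using norm_add_le (x - z) z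
        rw [secondDiff, hzero x (by linarith), hzero (x + z) (by linarith),
          hzero (x - z) (by linarith)]
        simp
    have hind : Integrable ((closedBall (0 : Space N) (R + 1)).indicator
        (fun _ => 2 * L * ‖z‖ ^ 2)) volume :=
      (integrable_indicator_iff measurableSet_closedBall).2
        (integrableOn_const measure_closedBall_lt_top.ne)
    refine (integral_mono (integrable_secondDiff hi z).abs hind hle).trans ?_
    rw [integral_indicator_const _ measurableSet_closedBall, smul_eq_mul, ← hV]
    have : 0 ≤ 4 * (∫ x, |φ x|) * ‖z‖ ^ 2 := by positivity
    linarith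
  · rw [min_eq_left (one_le_pow₀ (not_lt.1 hz)), mul_one]
    have i1 := (hi.comp_add_right z).abs
    have i2 := (hi.comp_sub_right z).abs
    have i3 := hi.abs.const_mul 2
    have e1 : ∫ x, |φ (x + z)| = ∫ x, |φ x| :=
      integral_add_right_eq_self (μ := volume) (fun x => |φ x|) z
    have e2 : ∫ x, |φ (x - z)| = ∫ x, |φ x| :=
      integral_sub_right_eq_self (μ := volume) (fun x => |φ x|) z
    have hle : ∫ x, |secondDiff φ x z| ≤ ∫ x, (|φ (x + z)| + |φ (x - z)|) + 2 * |φ x| := by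
      refine integral_mono (integrable_secondDiff hi z).abs ((i1.add i2).add i3) fun x => ?_
      simp only [secondDiff]
      refine (abs_sub _ _).trans ?_
      rw [abs_mul, abs_two]
      gcongr
      exact abs_add_le _ _
    rw [integral_add (by exact i1.add i2) i3, integral_add i1 i2, integral_const_mul, e1, e2] at hle
    have : 0 ≤ 2 * L * V := by positivity
    linarith

theorem integrable_prod_mul_secondDiff_test {N : ℕ} (hN : 1 ≤ N) {σ : ℝ} (hσ : 0 < σ ∧ σ < 2)
    {u φ : Space N → ℝ} (hu : Continuous u) {B : ℝ} (hB : ∀ x, |u x| ≤ B)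
    (hφ : ContDiff ℝ ∞ φ) (hs : HasCompactSupport φ) :
    Integrable (fun p : Space N × Space N =>
      u p.1 * (secondDiff φ p.1 p.2 / ‖p.2‖ ^ ((N : ℝ) + σ))) (volume.prod volume) := by
  have hB0 : 0 ≤ B := (abs_nonneg _).trans (hB 0)
  have hi : Integrable φ volume := hφ.continuous.integrable_of_hasCompactSupport hs
  obtain ⟨D, hD⟩ := exists_integral_abs_secondDiff_le hφ hs
  have hm : AEStronglyMeasurable (fun p : Space N × Space N =>
      u p.1 * (secondDiff φ p.1 p.2 / ‖p.2‖ ^ ((N : ℝ) + σ))) (volume.prod volume) :=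
    ((hu.comp continuous_fst).measurable.mul
      ((continuous_secondDiff hφ.continuous).measurable.div (by fun_prop))).aestronglyMeasurable
  refine (integrable_prod_iff' hm).2 ⟨Filter.Eventually.of_forall fun z => ?_, ?_⟩
  · exact ((integrable_secondDiff hi z).div_const (‖z‖ ^ ((N : ℝ) + σ))).bdd_mul hu.aestronglyMeasurable
      (Filter.Eventually.of_forall hB)
  · refine ((integrable_min_sq_div hN hσ).const_mul (B * D)).mono'
      hm.norm.prod_swap.integral_prod_right' (Filter.Eventually.of_forall fun z => ?_)
    have hk : 0 ≤ ‖z‖ ^ ((N : ℝ) + σ) := by positivity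
    rw [Real.norm_of_nonneg (integral_nonneg fun x => norm_nonneg _)]
    calc ∫ x, ‖u x * (secondDiff φ x z / ‖z‖ ^ ((N : ℝ) + σ))‖
        ≤ ∫ x, B * (|secondDiff φ x z| / ‖z‖ ^ ((N : ℝ) + σ)) := by
          refine integral_mono (((integrable_secondDiff hi z).div_const _).bdd_mul
            hu.aestronglyMeasurable (Filter.Eventually.of_forall hB)).norm
            (((integrable_secondDiff hi z).abs.div_const _).const_mul B) fun x => ?_
          simp only [Real.norm_eq_abs]
          rw [abs_mul, abs_div, abs_of_nonneg hk]
          gcongr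
          exact hB x
      _ = B * ((∫ x, |secondDiff φ x z|) / ‖z‖ ^ ((N : ℝ) + σ)) := by
          rw [integral_const_mul, integral_div]
      _ ≤ B * (D * min 1 (‖z‖ ^ 2) / ‖z‖ ^ ((N : ℝ) + σ)) := by gcongr; exact hD z
      _ = _ := by ring

theorem integrable_secondDiff_kernel {N : ℕ} {σ : ℝ} {u : Space N → ℝ} (hu : Continuous u)
    {M : ℝ} (hM0 : 0 ≤ M) {x : Space N}
    (hM : ∫⁻ z, ENNReal.ofReal |secondDiff u x z / ‖z‖ ^ ((N : ℝ) + σ)| ≤ ENNReal.ofReal M) :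
    Integrable (fun z => secondDiff u x z / ‖z‖ ^ ((N : ℝ) + σ)) volume ∧
      ∫ z, |secondDiff u x z / ‖z‖ ^ ((N : ℝ) + σ)| ≤ M := by
  have hc : Continuous fun z => secondDiff u x z := by unfold secondDiff; fun_prop
  have hm : Measurable fun z => secondDiff u x z / ‖z‖ ^ ((N : ℝ) + σ) :=
    hc.measurable.div (by fun_prop)
  refine ⟨⟨hm.aestronglyMeasurable, ?_⟩, ?_⟩
  · rw [hasFiniteIntegral_iff_norm]
    exact hM.trans_lt ENNReal.ofReal_lt_top
  · rw [integral_eq_lintegral_of_nonneg_ae (Filter.Eventually.of_forall fun z => abs_nonneg _)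
      hm.aestronglyMeasurable.norm]
    exact ENNReal.toReal_le_of_le_ofReal hM0 hM

theorem integrable_prod_test_mul_secondDiff {N : ℕ} {σ : ℝ}
    {u φ : Space N → ℝ} (hu : Continuous u) {M : ℝ} (hM0 : 0 ≤ M)
    (hM : ∀ x, ∫⁻ z, ENNReal.ofReal |secondDiff u x z / ‖z‖ ^ ((N : ℝ) + σ)| ≤ ENNReal.ofReal M)
    (hφ : Continuous φ) (hi : Integrable φ volume) :
    Integrable (fun p : Space N × Space N =>
      φ p.1 * (secondDiff u p.1 p.2 / ‖p.2‖ ^ ((N : ℝ) + σ))) (volume.prod volume) := by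
  have hm : AEStronglyMeasurable (fun p : Space N × Space N =>
      φ p.1 * (secondDiff u p.1 p.2 / ‖p.2‖ ^ ((N : ℝ) + σ))) (volume.prod volume) :=
    ((hφ.comp continuous_fst).measurable.mul
      ((continuous_secondDiff hu).measurable.div (by fun_prop))).aestronglyMeasurable
  refine (integrable_prod_iff hm).2 ⟨Filter.Eventually.of_forall fun x =>
    (integrable_secondDiff_kernel hu hM0 (hM x)).1.const_mul (φ x), ?_⟩
  refine (hi.norm.mul_const M).mono' hm.norm.integral_prod_right'
    (Filter.Eventually.of_forall fun x => ?_)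
  rw [Real.norm_of_nonneg (integral_nonneg fun x => norm_nonneg _)]
  simp only [norm_mul, Real.norm_eq_abs]
  rw [integral_const_mul]
  gcongr
  exact (integrable_secondDiff_kernel hu hM0 (hM x)).2

/-- The density is the second-difference integral of `u` itself. The two double integrals converge
absolutely for different reasons: smoothness of `φ` for one, the uniform kernel bound `hM` for the
other. -/
theorem exists_fracLaplacian_representation {N : ℕ} (hN : 1 ≤ N) {σ : ℝ} (hσ : 0 < σ ∧ σ < 2)
    {u : Space N → ℝ} (hu : Continuous u) {B : ℝ} (hB : ∀ x, |u x| ≤ B) {M : ℝ} (hM0 : 0 ≤ M)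
    (hM : ∀ x, ∫⁻ z, ENNReal.ofReal |secondDiff u x z / ‖z‖ ^ ((N : ℝ) + σ)| ≤
      ENNReal.ofReal M) :
    ∃ g : Space N → ℝ, MemLp g ⊤ volume ∧ FracLaplacianRepresentedBy σ u g := by
  set c := -(fracLaplacianConst N σ / 2) with hc
  have hm : Measurable (fun p : Space N × Space N =>
      secondDiff u p.1 p.2 / ‖p.2‖ ^ ((N : ℝ) + σ)) :=
    (continuous_secondDiff hu).measurable.div (by fun_prop)
  refine ⟨fun x => c * ∫ z, secondDiff u x z / ‖z‖ ^ ((N : ℝ) + σ), ?_, fun φ hφ hs => ?_⟩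
  · refine memLp_top_of_bound
      (hm.stronglyMeasurable.integral_prod_right'.aestronglyMeasurable.const_mul c) (|c| * M)
      (Filter.Eventually.of_forall fun x => ?_)
    rw [norm_mul, Real.norm_eq_abs]
    gcongr
    exact (norm_integral_le_integral_norm _).trans
      (integrable_secondDiff_kernel hu hM0 (hM x)).2
  · have hi : Integrable φ volume := hφ.continuous.integrable_of_hasCompactSupport hs
    have i1 := integrable_prod_mul_secondDiff_test hN hσ hu hB hφ hs
    have i2 := integrable_prod_test_mul_secondDiff hu hM0 hM hφ.continuous hi
    have e1 : ∀ x, u x * fracLaplacian σ φ x =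
        c * ∫ z, u x * (secondDiff φ x z / ‖z‖ ^ ((N : ℝ) + σ)) := fun x => by
      rw [fracLaplacian_eq_secondDiff hN hσ hφ hs, ← hc, integral_const_mul]
      ring
    have e2 : ∀ x, c * (∫ z, secondDiff u x z / ‖z‖ ^ ((N : ℝ) + σ)) * φ x =
        c * ∫ z, φ x * (secondDiff u x z / ‖z‖ ^ ((N : ℝ) + σ)) := fun x => by
      rw [integral_const_mul]
      ring
    simp only [e1, e2]
    refine ⟨i1.integral_prod_left.const_mul c, ?_⟩
    rw [integral_const_mul, integral_const_mul,
      integral_integral_swap (f := fun x z => u x * (secondDiff φ x z / ‖z‖ ^ ((N : ℝ) + σ))) i1,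
      integral_integral_swap (f := fun x z => φ x * (secondDiff u x z / ‖z‖ ^ ((N : ℝ) + σ))) i2]
    congr 2
    funext z
    simp only [← mul_div_assoc]
    rw [integral_div, integral_div, integral_mul_secondDiff_comm hu hB hi]

end NonlocalHJB

theorem mainTheorem5 {N : ℕ} (hN : 1 ≤ N)
    {A : Type*} [MetricSpace A] [TopologicalSpace.SeparableSpace A]
    (l σ : ℝ) (hl : 0 < l) (hσ : 0 < σ ∧ σ < 2)
    (f : A → NonlocalHJB.Space N → ℝ)
    (η : A → NonlocalHJB.Space N → NonlocalHJB.Space N)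
    (ν : A → Measure (NonlocalHJB.Space N))
    -- continuity of the data in the control and in the space variables
    (hf_cont : (∀ α, Continuous (f α)) ∧ ∀ x, Continuous fun α => f α x)
    (hη_cont : (∀ α, Continuous (η α)) ∧ ∀ z, Continuous fun α => η α z)
    -- uniform bounds on `f` in `W^{1,∞}` and on `η` in `L^∞`
    (hbound : ∃ K > 0, ∀ α,
      (∀ x, |f α x| ≤ K) ∧ (∀ x y, |f α x - f α y| ≤ K * ‖x - y‖) ∧ ∀ z, ‖η α z‖ ≤ K)
    -- linear bound on the jumps near the origin
    (hη_lin : ∃ K > 0, ∀ α z, ‖z‖ < 1 → ‖η α z‖ ≤ K * ‖z‖)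
    -- uniform Lévy condition
    (hν_levy : ∃ K > 0, ∀ α,
      (∫⁻ z in closedBall 0 1, ENNReal.ofReal (‖z‖ ^ 2) ∂(ν α)) + ν α (closedBall 0 1)ᶜ
        ≤ ENNReal.ofReal K)
    -- symmetry of the Lévy measures on the unit ball
    (hν_symm : ∀ α, ((ν α).restrict (ball 0 1)).map (fun z => -z) = (ν α).restrict (ball 0 1))
    -- absolute continuity and upper density bound of order `σ` on the unit ball
    (hν_ac : ∀ α, (ν α).restrict (ball 0 1) ≪ volume)
    (hν_upper : ∃ C > 0, ∀ α, ∀ᵐ z ∂(volume : Measure (NonlocalHJB.Space N)), ‖z‖ < 1 →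
      NonlocalHJB.ballDensity (ν α) z ≤ ENNReal.ofReal (C / ‖z‖ ^ ((N : ℝ) + σ)))
    -- oddness of the jump functions on the unit ball
    (hη_odd : ∀ α z, ‖z‖ < 1 → η α (-z) = -η α z)
    -- weak non-degeneracy: one control with an elliptic operator of order `σ`
    (hweak : ∃ α₀ : A,
      (∃ c > 0, ∀ᵐ z ∂(volume : Measure (NonlocalHJB.Space N)), ‖z‖ < 1 →
        ENNReal.ofReal (c / ‖z‖ ^ ((N : ℝ) + σ)) ≤ NonlocalHJB.ballDensity (ν α₀) z) ∧
      ∃ K ≥ 0, ∀ z, ‖z‖ < 1 → ‖η α₀ z - η α₀ 0 - z‖ ≤ K * ‖z‖ ^ 2)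
    -- uniform `C^{1,β}` bound on `f`
    (hf_holder : ∃ β : ℝ, max (σ - 1) 0 < β ∧ β ≤ 1 ∧ ∃ K > 0, ∀ α,
      Differentiable ℝ (f α) ∧ (∀ x, |f α x| ≤ K) ∧ (∀ x, ‖fderiv ℝ (f α) x‖ ≤ K) ∧
      ∀ x y, ‖fderiv ℝ (f α) x - fderiv ℝ (f α) y‖ ≤ K * ‖x - y‖ ^ β)
    (u : NonlocalHJB.Space N → ℝ)
    (hu : NonlocalHJB.IsViscositySolution l f η ν u) :
    ∃ g : NonlocalHJB.Space N → ℝ, MemLp g ⊤ volume ∧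
      NonlocalHJB.FracLaplacianRepresentedBy σ u g := by
  open NonlocalHJB in
  obtain ⟨K₁, hK₁, hb⟩ := hbound
  obtain ⟨K₂, hK₂, hlin⟩ := hη_lin
  obtain ⟨K₃, hK₃, hlevy⟩ := hν_levy
  obtain ⟨C, hC, hup⟩ := hν_upper
  obtain ⟨α₀, ⟨c, hc, hlow⟩, K₀, hK₀, hid⟩ := hweak
  obtain ⟨β, hβ, -, K₄, hK₄, hf⟩ := hf_holder
  obtain ⟨B, hB⟩ := hu.bounded
  have hβ0 : 0 < β := (le_max_right _ _).trans_lt hβ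
  have hβσ : σ < 1 + β := by linarith [(le_max_left (σ - 1) 0).trans_lt hβ]
  have : Nonempty A := ⟨α₀⟩
  have hlev := fun α => lintegral_min_sq_le (hlevy α)
  -- The sum of the three positive constants serves in every bound at once.
  have H : IsUniformLevyFamily σ (K₁ + K₂ + K₃) C η ν :=
    { pos := by positivity
      const_nonneg := hC.le
      continuous := hη_cont.1
      bound := fun α z => ((hb α).2.2 z).trans (by linarith)
      lin := fun α z hz => (hlin α z hz).trans (by gcongr; linarith)
      levy := fun α => (hlev α).trans (ENNReal.ofReal_le_ofReal (by linarith))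
      upper := fun α => restrict_ball_le_stableBall hN (hlev α) (hν_ac α) (hup α) }
  have hlip := hu.lipschitz hN hσ hl H (fun α => (hb α).1) (fun α => (hb α).2.1) hK₁.le
  have hsc := hu.semiconcave hN hσ hl H (fun α => (hb α).1) (fun α => (hb α).2.1) hK₁.le
    hβ0 hK₄.le (fun α => (hf α).1) (fun α => (hf α).2.2.2)
  have hlow' := stableBall_le_restrict_ball hN (hlev α₀) (hν_ac α₀) hlow
  have hη0 : η α₀ 0 = 0 := by simpa using hlin α₀ 0 (by simp)
  have hD : 0 ≤ 2 * K₄ / l := by positivity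
  obtain ⟨M, hM⟩ := exists_lintegral_secondDiff_le hN hσ hc hu.continuous (by positivity) hlip hβσ
    hD H.pos.le hsc (hη_cont.1 α₀) (H.lin α₀) hK₀
    (fun z hz => by simpa [hη0] using hid z hz)
    (hu.subsolution.lintegral_stableBall_le hN hσ hl H (fun α => (hb α).1) hu.continuous hB hβσ hD
      hsc (hν_symm α₀) (hη_odd α₀) hlow')
  obtain ⟨M', hM'0, hM'⟩ := lintegral_secondDiff_kernel_le hN hσ hc hu.continuous hB hM
  exact exists_fracLaplacian_representation hN hσ hu.continuous hB hM'0 hM'
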